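/- Let $k$ be a field, with $\otimes=\otimes_k$. A quasi-Hopf algebra over $k$ is an associative unital $k$-algebra $H$ with unital algebra homomorphisms $\Delta:H\to H\otimes H$ and $\varepsilon:H\to k$, an invertible element $\Phi=X^1\otimes X^2\otimes X^3\in H\otimes H\otimes H$ with inverse $\Phi^{-1}=x^1\otimes x^2\otimes x^3=y^1\otimes y^2\otimes y^3$ (summations understood), an anti-automorphism $S$ of the algebra $H$, and elements $\alpha,\beta\in H$, such that, writing $\Delta(h)=h_1\otimes h_2$, for all $h\in H$: $$(\mathrm{id}\otimes\Delta)(\Delta(h))=\Phi\,(\Delta\otimes\mathrm{id})(\Delta(h))\,\Phi^{-1},\qquad (\mathrm{id}\otimes\varepsilon)(\Delta(h))=h\otimes 1,\qquad (\varepsilon\otimes\mathrm{id})(\Delta(h))=1\otimes h,$$ $$(1\otimes\Phi)(\mathrm{id}\otimes\Delta\otimes\mathrm{id})(\Phi)(\Phi\otimes 1)=(\mathrm{id}\otimes\mathrm{id}\otimes\Delta)(\Phi)(\Delta\otimes\mathrm{id}\otimes\mathrm{id})(\Phi),$$ $$(\varepsilon\otimes\mathrm{id}\otimes\mathrm{id})(\Phi)=(\mathrm{id}\otimes\varepsilon\otimes\mathrm{id})(\Phi)=(\mathrm{id}\otimes\mathrm{id}\otimes\varepsilon)(\Phi)=1\otimes1\otimes1,$$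 $$S(h_1)\alpha h_2=\varepsilon(h)\alpha,\quad h_1\beta S(h_2)=\varepsilon(h)\beta,\quad X^1\beta S(X^2)\alpha X^3=1,\quad S(x^1)\alpha x^2\beta S(x^3)=1.$$ Let $H^*=\mathrm{Hom}_k(H,k)$, with the convolution product $(\varphi\psi)(h)=\varphi(h_1)\psi(h_2)$ and the regular actions $(h\rightharpoonup\varphi)(h')=\varphi(h'h)$ and $(\varphi\leftharpoonup h)(h')=\varphi(hh')$. Theorem. Let $H$ be a finite-dimensional quasi-Hopf algebra over $k$. The (Hausser–Nill) two-sided crossed product $H \mathbin{>\!\triangleleft} H^* \mathbin{\triangleright\!<} H$, that is, the vector space $H\otimes H^*\otimes H$ with the bilinear multiplication determined by $$(h\otimes\varphi\otimes l)(h'\otimes\varphi'\otimes l')=hh'_1x^1\otimes(y^1\rightharpoonup\varphi\leftharpoonup h'_2x^2)(y^2l_1\rightharpoonup\varphi'\leftharpoonup x^3)\otimes y^3l_2l',$$ is an associative algebra with unit $1\otimes\varepsilon\otimes1$, and it is isomorphic, as a unital associative $k$-algebra, to $\mathrm{End}_k(H)\otimes H$, where $\mathrm{End}_k(H)$ is the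 algebra of $k$-linear endomorphisms of $H$ under composition. -/

import Mathlib

open scoped TensorProduct

/-- A quasi-bialgebra structure `(Δ, ε, Φ)` on the associative unital `k`-algebra `H`.
Iterated tensor powers of `H` are bracketed to the right, `H ⊗ (H ⊗ H)` and
`H ⊗ (H ⊗ (H ⊗ H))`; the canonical (re-bracketing) algebra isomorphisms are written out. -/
structure QuasiBialgebra (k H : Type*) [Field k] [Ring H] [Algebra k H] where
  /-- the coproduct `Δ` -/
  comul : H →ₐ[k] H ⊗[k] H
  /-- the counit `ε` -/
  counit : H →ₐ[k] k
  /-- the reassociator `Φ`, with inverse `Φ⁻¹` -/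
  reassoc : (H ⊗[k] (H ⊗[k] H))ˣ
  /-- `(id ⊗ Δ)(Δ(h)) = Φ (Δ ⊗ id)(Δ(h)) Φ⁻¹` -/
  quasi_coassoc : ∀ h : H,
    Algebra.TensorProduct.map (AlgHom.id k H) comul (comul h) =
      (reassoc : H ⊗[k] (H ⊗[k] H)) *
        Algebra.TensorProduct.assoc k k k H H H
          (Algebra.TensorProduct.map comul (AlgHom.id k H) (comul h)) *
        ((reassoc⁻¹ : (H ⊗[k] (H ⊗[k] H))ˣ) : H ⊗[k] (H ⊗[k] H))
  /-- `(id ⊗ ε)(Δ(h)) = h ⊗ 1` -/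
  id_counit_comul : ∀ h : H,
    Algebra.TensorProduct.map (AlgHom.id k H) counit (comul h) = h ⊗ₜ[k] (1 : k)
  /-- `(ε ⊗ id)(Δ(h)) = 1 ⊗ h` -/
  counit_id_comul : ∀ h : H,
    Algebra.TensorProduct.map counit (AlgHom.id k H) (comul h) = (1 : k) ⊗ₜ[k] h
  /-- `(1 ⊗ Φ) (id ⊗ Δ ⊗ id)(Φ) (Φ ⊗ 1) = (id ⊗ id ⊗ Δ)(Φ) (Δ ⊗ id ⊗ id)(Φ)` -/
  pentagon :
    ((1 : H) ⊗ₜ[k] (reassoc : H ⊗[k] (H ⊗[k] H))) *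
        Algebra.TensorProduct.map (AlgHom.id k H)
          ((Algebra.TensorProduct.assoc k k k H H H).toAlgHom.comp
            (Algebra.TensorProduct.map comul (AlgHom.id k H)))
          (reassoc : H ⊗[k] (H ⊗[k] H)) *
        Algebra.TensorProduct.map (AlgHom.id k H)
          (Algebra.TensorProduct.assoc k k k H H H).toAlgHom
          (Algebra.TensorProduct.assoc k k k H (H ⊗[k] H) H
            ((reassoc : H ⊗[k] (H ⊗[k] H)) ⊗ₜ[k] (1 : H))) =
      Algebra.TensorProduct.map (AlgHom.id k H)
          (Algebra.TensorProduct.map (AlgHom.id k H) comul)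
          (reassoc : H ⊗[k] (H ⊗[k] H)) *
        Algebra.TensorProduct.assoc k k k H H (H ⊗[k] H)
          (Algebra.TensorProduct.map comul (AlgHom.id k (H ⊗[k] H))
            (reassoc : H ⊗[k] (H ⊗[k] H)))
  /-- `(ε ⊗ id ⊗ id)(Φ) = 1 ⊗ 1 ⊗ 1` -/
  counit_fst : Algebra.TensorProduct.map counit (AlgHom.id k (H ⊗[k] H))
    (reassoc : H ⊗[k] (H ⊗[k] H)) = 1
  /-- `(id ⊗ ε ⊗ id)(Φ) = 1 ⊗ 1 ⊗ 1` -/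
  counit_snd : Algebra.TensorProduct.map (AlgHom.id k H)
    (Algebra.TensorProduct.map counit (AlgHom.id k H)) (reassoc : H ⊗[k] (H ⊗[k] H)) = 1
  /-- `(id ⊗ id ⊗ ε)(Φ) = 1 ⊗ 1 ⊗ 1` -/
  counit_trd : Algebra.TensorProduct.map (AlgHom.id k H)
    (Algebra.TensorProduct.map (AlgHom.id k H) counit) (reassoc : H ⊗[k] (H ⊗[k] H)) = 1

/-- The linear map `h ↦ S(h)` underlying an algebra anti-automorphism `S` of `H`. -/
def antiLin {k H : Type*} [Field k] [Ring H] [Algebra k H] (S : H ≃ₐ[k] Hᵐᵒᵖ) : H →ₗ[k] H :=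
  (MulOpposite.opLinearEquiv k : H ≃ₗ[k] Hᵐᵒᵖ).symm.toLinearMap ∘ₗ S.toLinearMap

/-- A quasi-Hopf algebra structure on `H`: a quasi-bialgebra structure with an anti-automorphism
`S` of the algebra `H` and elements `α, β` of `H`. -/
structure QuasiHopfAlgebra (k H : Type*) [Field k] [Ring H] [Algebra k H] extends
    QuasiBialgebra k H where
  /-- the antipode `S`, an algebra anti-automorphism of `H` -/
  antipode : H ≃ₐ[k] Hᵐᵒᵖ
  /-- the element `α` -/
  alpha : H
  /-- the element `β` -/
  beta : H
  /-- `S(h₁) α h₂ = ε(h) α` -/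
  antipode_alpha : ∀ h : H,
    LinearMap.mul' k H
      (TensorProduct.map (LinearMap.mulRight k alpha ∘ₗ antiLin antipode) LinearMap.id
        (comul h)) = counit h • alpha
  /-- `h₁ β S(h₂) = ε(h) β` -/
  beta_antipode : ∀ h : H,
    LinearMap.mul' k H
      (TensorProduct.map (LinearMap.mulRight k beta) (antiLin antipode)
        (comul h)) = counit h • beta
  /-- `X¹ β S(X²) α X³ = 1`, where `Φ = X¹ ⊗ X² ⊗ X³` -/
  reassoc_antipode :
    LinearMap.mul' k H
      (TensorProduct.map (LinearMap.mulRight k beta)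
        (LinearMap.mul' k H ∘ₗ
          TensorProduct.map (LinearMap.mulRight k alpha ∘ₗ antiLin antipode) LinearMap.id)
        (reassoc : H ⊗[k] (H ⊗[k] H))) = 1
  /-- `S(x¹) α x² β S(x³) = 1`, where `Φ⁻¹ = x¹ ⊗ x² ⊗ x³` -/
  reassoc_inv_antipode :
    LinearMap.mul' k H
      (TensorProduct.map (LinearMap.mulRight k alpha ∘ₗ antiLin antipode)
        (LinearMap.mul' k H ∘ₗ
          TensorProduct.map (LinearMap.mulRight k beta) (antiLin antipode))
        ((reassoc⁻¹ : (H ⊗[k] (H ⊗[k] H))ˣ) : H ⊗[k] (H ⊗[k] H))) = 1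

namespace QuasiBialgebra

section regular

variable (k H : Type*) [Field k] [Ring H] [Algebra k H]

/-- The left regular action of `H` on `H*`: `⟨h ⇀ φ, h'⟩ = φ(h' h)`. -/
def regL : H →ₗ[k] Module.Dual k H →ₗ[k] Module.Dual k H :=
  LinearMap.mk₂ k (fun h φ => φ ∘ₗ LinearMap.mulRight k h)
    (by intros; ext; simp [mul_add]) (by intros; ext; simp)
    (by intros; ext; simp) (by intros; ext; simp)

/-- The right regular action of `H` on `H*`: `⟨φ ↼ h, h'⟩ = φ(h h')`. -/
def regR : H →ₗ[k] Module.Dual k H →ₗ[k] Module.Dual k H :=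
  LinearMap.mk₂ k (fun h φ => φ ∘ₗ LinearMap.mulLeft k h)
    (by intros; ext; simp [add_mul]) (by intros; ext; simp)
    (by intros; ext; simp) (by intros; ext; simp)

@[simp] theorem regL_apply (h : H) (φ : Module.Dual k H) (h' : H) :
    regL k H h φ h' = φ (h' * h) := rfl

@[simp] theorem regR_apply (h : H) (φ : Module.Dual k H) (h' : H) :
    regR k H h φ h' = φ (h * h') := rfl

end regular

variable {k H : Type*} [Field k] [Ring H] [Algebra k H] (Q : QuasiBialgebra k H)

/-- The convolution on `H*`: `⟨φ ψ, h⟩ = φ(h₁) ψ(h₂)`. -/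
def conv : Module.Dual k H →ₗ[k] Module.Dual k H →ₗ[k] Module.Dual k H :=
  LinearMap.mk₂ k
    (fun φ ψ => LinearMap.mul' k k ∘ₗ TensorProduct.map φ ψ ∘ₗ Q.comul.toLinearMap)
    (by intros; ext; simp [TensorProduct.map_add_left])
    (by intros; ext; simp [TensorProduct.map_smul_left])
    (by intros; ext; simp [TensorProduct.map_add_right])
    (by intros; ext; simp [TensorProduct.map_smul_right])

theorem conv_apply (φ ψ : Module.Dual k H) (h : H) :
    Q.conv φ ψ h = LinearMap.mul' k k (TensorProduct.map φ ψ (Q.comul h)) := rfl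

/-- `(h, h') ↦ h h'₁ x¹ ⊗ h'₂ x² ⊗ x³`, where `Φ⁻¹ = x¹ ⊗ x² ⊗ x³`. -/
def leftLeg : H →ₗ[k] H →ₗ[k] H ⊗[k] (H ⊗[k] H) :=
  LinearMap.mk₂ k
    (fun h h' => (h ⊗ₜ[k] (1 : H ⊗[k] H)) *
      Algebra.TensorProduct.assoc k k k H H H (Q.comul h' ⊗ₜ[k] (1 : H)) *
      ((Q.reassoc⁻¹ : (H ⊗[k] (H ⊗[k] H))ˣ) : H ⊗[k] (H ⊗[k] H)))
    (by intros; simp [TensorProduct.add_tmul, add_mul])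
    (by intros; rw [← TensorProduct.smul_tmul', smul_mul_assoc, smul_mul_assoc])
    (by intros; simp [TensorProduct.add_tmul, add_mul, mul_add])
    (by intros; rw [map_smul, ← TensorProduct.smul_tmul', map_smul, mul_smul_comm,
      smul_mul_assoc])

/-- `(l, l') ↦ y¹ ⊗ y² l₁ ⊗ y³ l₂ l'`, where `Φ⁻¹ = y¹ ⊗ y² ⊗ y³`. -/
def rightLeg : H →ₗ[k] H →ₗ[k] H ⊗[k] (H ⊗[k] H) :=
  LinearMap.mk₂ k
    (fun l l' => ((Q.reassoc⁻¹ : (H ⊗[k] (H ⊗[k] H))ˣ) : H ⊗[k] (H ⊗[k] H)) *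
      ((1 : H) ⊗ₜ[k] Q.comul l) * ((1 : H) ⊗ₜ[k] ((1 : H) ⊗ₜ[k] l')))
    (by intros; simp [TensorProduct.tmul_add, add_mul, mul_add])
    (by intros; rw [map_smul, TensorProduct.tmul_smul, mul_smul_comm, smul_mul_assoc])
    (by intros; simp [TensorProduct.tmul_add, mul_add])
    (by intros; rw [TensorProduct.tmul_smul, TensorProduct.tmul_smul, mul_smul_comm])

/-- `(u² ⊗ u³) ⊗ ((φ ⊗ φ') ⊗ (w¹ ⊗ w²)) ↦ (w¹ ⇀ φ ↼ u²) (w² ⇀ φ' ↼ u³)`. -/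
def dualLeg : (H ⊗[k] H) ⊗[k] ((Module.Dual k H ⊗[k] Module.Dual k H) ⊗[k] (H ⊗[k] H)) →ₗ[k]
    Module.Dual k H :=
  TensorProduct.lift Q.conv ∘ₗ
    TensorProduct.lift (TensorProduct.map₂ (regL k H) (regL k H)).flip ∘ₗ
    TensorProduct.map (TensorProduct.lift (TensorProduct.map₂ (regR k H) (regR k H)))
      LinearMap.id ∘ₗ
    (TensorProduct.assoc k _ _ _).symm.toLinearMap

/-- `(u¹ ⊗ u² ⊗ u³) ⊗ ((φ ⊗ φ') ⊗ (w¹ ⊗ w² ⊗ w³)) ↦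
u¹ ⊗ (w¹ ⇀ φ ↼ u²) (w² ⇀ φ' ↼ u³) ⊗ w³`. -/
def assemble : (H ⊗[k] (H ⊗[k] H)) ⊗[k]
      ((Module.Dual k H ⊗[k] Module.Dual k H) ⊗[k] (H ⊗[k] (H ⊗[k] H))) →ₗ[k]
    H ⊗[k] (Module.Dual k H ⊗[k] H) :=
  TensorProduct.map LinearMap.id
    (TensorProduct.map Q.dualLeg LinearMap.id ∘ₗ
      (TensorProduct.assoc k _ _ _).symm.toLinearMap ∘ₗ
      TensorProduct.map LinearMap.id
        ((TensorProduct.assoc k _ _ _).symm.toLinearMap ∘ₗ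
          TensorProduct.map LinearMap.id (TensorProduct.assoc k H H H).symm.toLinearMap)) ∘ₗ
  (TensorProduct.assoc k _ _ _).toLinearMap

theorem assemble_tmul (u₁ u₂ u₃ w₁ w₂ w₃ : H) (φ ψ : Module.Dual k H) :
    Q.assemble ((u₁ ⊗ₜ[k] (u₂ ⊗ₜ[k] u₃)) ⊗ₜ[k]
        ((φ ⊗ₜ[k] ψ) ⊗ₜ[k] (w₁ ⊗ₜ[k] (w₂ ⊗ₜ[k] w₃)))) =
      u₁ ⊗ₜ[k] (Q.conv (regL k H w₁ (regR k H u₂ φ)) (regL k H w₂ (regR k H u₃ ψ)) ⊗ₜ[k] w₃) :=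
  rfl

/-- The multiplication of the two-sided crossed product `H >◁ H* ▷< H`, on `H ⊗ H* ⊗ H`:
`(h ⊗ φ ⊗ l)(h' ⊗ φ' ⊗ l') =
h h'₁ x¹ ⊗ (y¹ ⇀ φ ↼ h'₂ x²) (y² l₁ ⇀ φ' ↼ x³) ⊗ y³ l₂ l'`,
where `Φ⁻¹ = x¹ ⊗ x² ⊗ x³ = y¹ ⊗ y² ⊗ y³`. -/
def crossedMul : H ⊗[k] (Module.Dual k H ⊗[k] H) →ₗ[k] H ⊗[k] (Module.Dual k H ⊗[k] H) →ₗ[k]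
    H ⊗[k] (Module.Dual k H ⊗[k] H) :=
  (TensorProduct.map₂ Q.leftLeg
    (TensorProduct.map₂ (TensorProduct.mk k (Module.Dual k H) (Module.Dual k H))
      Q.rightLeg)).compr₂ Q.assemble

/-- The multiplication formula of the two-sided crossed product in terms of components
`Δ(h') = ∑ a ⊗ b`, `Δ(l) = ∑ c ⊗ d`, `Φ⁻¹ = ∑ x¹ ⊗ x² ⊗ x³`. -/
theorem crossedMul_tmul {ι κ τ : Type*} (s : Finset ι) (t : Finset κ) (r : Finset τ)
    (a b : ι → H) (c d : κ → H) (x₁ x₂ x₃ : τ → H) (h h' l l' : H) (φ φ' : Module.Dual k H)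
    (hh' : Q.comul h' = ∑ i ∈ s, a i ⊗ₜ[k] b i) (hl : Q.comul l = ∑ j ∈ t, c j ⊗ₜ[k] d j)
    (hx : ((Q.reassoc⁻¹ : (H ⊗[k] (H ⊗[k] H))ˣ) : H ⊗[k] (H ⊗[k] H)) =
      ∑ p ∈ r, x₁ p ⊗ₜ[k] (x₂ p ⊗ₜ[k] x₃ p)) :
    Q.crossedMul (h ⊗ₜ[k] (φ ⊗ₜ[k] l)) (h' ⊗ₜ[k] (φ' ⊗ₜ[k] l')) =
      ∑ i ∈ s, ∑ p ∈ r, ∑ q ∈ r, ∑ j ∈ t,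
        (h * a i * x₁ p) ⊗ₜ[k]
          (Q.conv (regL k H (x₁ q) (regR k H (b i * x₂ p) φ))
              (regL k H (x₂ q * c j) (regR k H (x₃ p) φ')) ⊗ₜ[k]
            (x₃ q * d j * l')) := by
  have hL : Q.leftLeg h h' = ∑ i ∈ s, ∑ p ∈ r,
      (h * a i * x₁ p) ⊗ₜ[k] ((b i * x₂ p) ⊗ₜ[k] x₃ p) := by
    simp [leftLeg, hh', hx, TensorProduct.sum_tmul, Finset.mul_sum, Finset.sum_mul,
      Algebra.TensorProduct.one_def]
    rw [Finset.sum_comm]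
  have hR : Q.rightLeg l l' = ∑ q ∈ r, ∑ j ∈ t,
      x₁ q ⊗ₜ[k] ((x₂ q * c j) ⊗ₜ[k] (x₃ q * d j * l')) := by
    simp [rightLeg, hl, hx, TensorProduct.tmul_sum, Finset.mul_sum, Finset.sum_mul]
  change Q.assemble (Q.leftLeg h h' ⊗ₜ[k] ((φ ⊗ₜ[k] φ') ⊗ₜ[k] Q.rightLeg l l')) = _
  rw [hL, hR]
  simp only [TensorProduct.sum_tmul]
  simp only [TensorProduct.tmul_sum]
  simp only [map_sum, assemble_tmul]

/-- The unit `1 ⊗ ε ⊗ 1` of the two-sided crossed product. -/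
def crossedOne : H ⊗[k] (Module.Dual k H ⊗[k] H) :=
  (1 : H) ⊗ₜ[k] (Q.counit.toLinearMap ⊗ₜ[k] (1 : H))

end QuasiBialgebra

/-!
The crossed product acts faithfully on `H ⊗ H`, by `h ⊗ φ ⊗ l ↦ L_h D_φ R_l` with
`L_h(m) = Δ(h) m`, `R_l(m) = m (1 ⊗ S⁻¹(l))` and
`D_φ(m) = (id ⊗ id ⊗ φ)(Φ⁻¹ (id ⊗ Δ)(m) (1 ⊗ g))`. Here `g` is a version of Drinfeld's twist: it is
a right-handed intertwiner between `Δ ∘ S⁻¹` and `S⁻¹ ⊗ S⁻¹`, and the cocycle identity it satisfies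
is exactly what makes the action multiplicative.

The twist drops out of the image: since `1` lies in the two-sided ideal generated by `S⁻¹(α)`, the
image also contains `m ↦ (id ⊗ id ⊗ φ)(Φ⁻¹ (id ⊗ Δ)(m))`. When `H` is finite dimensional, so that
every endomorphism of `H` is a sum of maps of rank one, contracting the last two legs with `β` and
`S` recovers all `id ⊗ f`, hence all `L_a ⊗ f`, where now `L_a` is left multiplication on `H`. Thus
the image contains the faithful image of `End(H) ⊗ H`, which has the dimension of the crossed
product.
-/

section TensorPower

open TensorProduct

-- The ring structure of the four-fold tensor power needs deeper instance search than the default.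
set_option maxSynthPendingDepth 6

section Induction

variable {k M N P R : Type*} [CommSemiring k] [AddCommMonoid M] [Module k M] [AddCommMonoid N]
  [Module k N] [AddCommMonoid P] [Module k P] [AddCommMonoid R] [Module k R]

theorem tensor_induction_three {p : M ⊗[k] (N ⊗[k] P) → Prop} (w : M ⊗[k] (N ⊗[k] P))
    (zero : p 0) (add : ∀ x y, p x → p y → p (x + y))
    (tmul : ∀ a b c, p (a ⊗ₜ (b ⊗ₜ c))) : p w := by
  induction w with
  | zero => exact zero
  | add x y hx hy => exact add x y hx hy
  | tmul a w =>
    induction w with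
    | zero => rwa [tmul_zero]
    | add x y hx hy => rw [tmul_add]; exact add _ _ hx hy
    | tmul b c => exact tmul a b c

theorem tensor_induction_four {p : M ⊗[k] (N ⊗[k] (P ⊗[k] R)) → Prop}
    (w : M ⊗[k] (N ⊗[k] (P ⊗[k] R))) (zero : p 0) (add : ∀ x y, p x → p y → p (x + y))
    (tmul : ∀ a b c d, p (a ⊗ₜ (b ⊗ₜ (c ⊗ₜ d)))) : p w := by
  induction w using tensor_induction_three with
  | zero => exact zero
  | add x y hx hy => exact add x y hx hy
  | tmul a b w =>
    induction w with
    | zero => rwa [tmul_zero, tmul_zero]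
    | add x y hx hy => rw [tmul_add, tmul_add]; exact add _ _ hx hy
    | tmul c d => exact tmul a b c d

theorem induction_smulRight [Module.Free k M] [Module.Finite k M] {p : (M →ₗ[k] N) → Prop}
    (f : M →ₗ[k] N) (zero : p 0) (add : ∀ f g, p f → p g → p (f + g))
    (smulRight : ∀ (φ : Module.Dual k M) (y : N), p (φ.smulRight y)) : p f := by
  obtain ⟨x, rfl⟩ := (dualTensorHomEquiv k M N).surjective f
  induction x with
  | zero => simpa using zero
  | add x y hx hy => simpa only [map_add] using add _ _ hx hy
  | tmul φ y => exact smulRight φ y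

end Induction

theorem one_tmul_mul {k A B : Type*} [CommSemiring k] [Semiring A] [Algebra k A] [Semiring B]
    [Algebra k B] (v w : B) : (1 : A) ⊗ₜ[k] (v * w) = 1 ⊗ₜ v * 1 ⊗ₜ w := by
  rw [Algebra.TensorProduct.tmul_mul_tmul, one_mul]

variable {k H : Type*} [CommSemiring k] [Semiring H] [Algebra k H]

variable (k H) in
/-- `a ⊗ b ↦ a ⊗ b ⊗ 1`. -/
def appendTwo : H ⊗[k] H →ₐ[k] H ⊗[k] (H ⊗[k] H) :=
  Algebra.TensorProduct.map (AlgHom.id k H) Algebra.TensorProduct.includeLeft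

variable (k H) in
/-- `a ⊗ b ⊗ c ↦ a ⊗ b ⊗ c ⊗ 1`. -/
def appendThree : H ⊗[k] (H ⊗[k] H) →ₐ[k] H ⊗[k] (H ⊗[k] (H ⊗[k] H)) :=
  Algebra.TensorProduct.map (AlgHom.id k H) (appendTwo k H)

@[simp] theorem appendTwo_tmul (a b : H) : appendTwo k H (a ⊗ₜ b) = a ⊗ₜ (b ⊗ₜ 1) := rfl

@[simp] theorem appendThree_tmul (a : H) (w : H ⊗[k] H) :
    appendThree k H (a ⊗ₜ w) = a ⊗ₜ appendTwo k H w := rfl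

theorem appendTwo_eq_assoc (v : H ⊗[k] H) :
    appendTwo k H v = Algebra.TensorProduct.assoc k k k H H H (v ⊗ₜ 1) := by
  induction v with
  | zero => simp
  | add u v hu hv => simp only [map_add, add_tmul, hu, hv]
  | tmul a b => rfl

theorem appendTwo_mul_assoc_tmul (v w : H ⊗[k] H) (c : H) :
    appendTwo k H v * TensorProduct.assoc k H H H (w ⊗ₜ c) =
      TensorProduct.assoc k H H H ((v * w) ⊗ₜ c) := by
  rw [appendTwo_eq_assoc, ← one_mul c, ← Algebra.TensorProduct.tmul_mul_tmul, one_mul]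
  exact (map_mul (Algebra.TensorProduct.assoc k k k H H H) (v ⊗ₜ 1) (w ⊗ₜ c)).symm

theorem assoc_tmul_mul_appendTwo (v w : H ⊗[k] H) (c : H) :
    TensorProduct.assoc k H H H (w ⊗ₜ c) * appendTwo k H v =
      TensorProduct.assoc k H H H ((w * v) ⊗ₜ c) := by
  rw [appendTwo_eq_assoc, ← mul_one c, ← Algebra.TensorProduct.tmul_mul_tmul, mul_one]
  exact (map_mul (Algebra.TensorProduct.assoc k k k H H H) (w ⊗ₜ c) (v ⊗ₜ 1)).symm

theorem appendThree_eq_assoc (w : H ⊗[k] (H ⊗[k] H)) :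
    appendThree k H w = Algebra.TensorProduct.map (AlgHom.id k H)
      (Algebra.TensorProduct.assoc k k k H H H).toAlgHom
      (Algebra.TensorProduct.assoc k k k H (H ⊗[k] H) H (w ⊗ₜ[k] (1 : H))) := by
  have h : (appendThree k H) = (Algebra.TensorProduct.map (AlgHom.id k H)
      (Algebra.TensorProduct.assoc k k k H H H).toAlgHom).comp
      ((Algebra.TensorProduct.assoc k k k H (H ⊗[k] H) H).toAlgHom.comp
        Algebra.TensorProduct.includeLeft) := by
    ext <;> rfl
  exact DFunLike.congr_fun h w

/-- The slice map `a ⊗ b ⊗ c ↦ φ(c) a ⊗ b`. -/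
def evalTrd : Module.Dual k H →ₗ[k] H ⊗[k] (H ⊗[k] H) →ₗ[k] H ⊗[k] H :=
  LinearMap.lTensorHom H ∘ₗ LinearMap.compRight k (TensorProduct.rid k H).toLinearMap ∘ₗ
    LinearMap.lTensorHom H

/-- The slice map `a ⊗ b ⊗ c ⊗ d ↦ φ(c) ψ(d) a ⊗ b`. -/
def evalTrdFth (φ ψ : Module.Dual k H) : H ⊗[k] (H ⊗[k] (H ⊗[k] H)) →ₗ[k] H ⊗[k] H :=
  evalTrd φ ∘ₗ LinearMap.lTensor H (evalTrd ψ)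

@[simp] theorem evalTrd_tmul (φ : Module.Dual k H) (a b c : H) :
    evalTrd φ (a ⊗ₜ (b ⊗ₜ c)) = φ c • a ⊗ₜ b :=
  tmul_smul _ _ _

@[simp] theorem evalTrdFth_tmul (φ ψ : Module.Dual k H) (a b c d : H) :
    evalTrdFth φ ψ (a ⊗ₜ (b ⊗ₜ (c ⊗ₜ d))) = (φ c * ψ d) • a ⊗ₜ b := by
  simp [evalTrdFth, smul_smul, mul_comm]

theorem evalTrd_appendTwo_mul (φ : Module.Dual k H) (v : H ⊗[k] H) (w : H ⊗[k] (H ⊗[k] H)) :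
    evalTrd φ (appendTwo k H v * w) = v * evalTrd φ w := by
  induction w using tensor_induction_three with
  | zero => simp
  | add x y hx hy => simp only [mul_add, map_add, hx, hy]
  | tmul a b c =>
    induction v with
    | zero => simp
    | add x y hx hy => simp only [add_mul, map_add, hx, hy]
    | tmul d e => simp

theorem evalTrd_mul_appendTwo (φ : Module.Dual k H) (v : H ⊗[k] H) (w : H ⊗[k] (H ⊗[k] H)) :
    evalTrd φ (w * appendTwo k H v) = evalTrd φ w * v := by
  induction w using tensor_induction_three with
  | zero => simp
  | add x y hx hy => simp only [add_mul, map_add, hx, hy]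
  | tmul a b c =>
    induction v with
    | zero => simp
    | add x y hx hy => simp only [mul_add, map_add, hx, hy]
    | tmul d e => simp

theorem lTensor_evalTrd_appendThree_mul (ψ : Module.Dual k H) (w : H ⊗[k] (H ⊗[k] H))
    (y : H ⊗[k] (H ⊗[k] (H ⊗[k] H))) :
    LinearMap.lTensor H (evalTrd ψ) (appendThree k H w * y) =
      w * LinearMap.lTensor H (evalTrd ψ) y := by
  induction y with
  | zero => simp
  | add x y hx hy => simp only [mul_add, map_add, hx, hy]
  | tmul a y =>
    induction w with
    | zero => simp
    | add u v hu hv => simp only [add_mul, map_add, hu, hv]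
    | tmul b v => simp [evalTrd_appendTwo_mul]

theorem lTensor_evalTrd_mul_appendThree (ψ : Module.Dual k H) (w : H ⊗[k] (H ⊗[k] H))
    (y : H ⊗[k] (H ⊗[k] (H ⊗[k] H))) :
    LinearMap.lTensor H (evalTrd ψ) (y * appendThree k H w) =
      LinearMap.lTensor H (evalTrd ψ) y * w := by
  induction y with
  | zero => simp
  | add x y hx hy => simp only [add_mul, map_add, hx, hy]
  | tmul a y =>
    induction w with
    | zero => simp
    | add u v hu hv => simp only [mul_add, map_add, hu, hv]
    | tmul b v => simp [evalTrd_mul_appendTwo]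

variable (k H) in
/-- `a ⊗ b ⊗ c ↦ a ⊗ b t(c)`. -/
def mulTrd : Module.End k H →ₗ[k] H ⊗[k] (H ⊗[k] H) →ₗ[k] H ⊗[k] H :=
  LinearMap.lTensorHom H ∘ₗ LinearMap.compRight k (LinearMap.mul' k H) ∘ₗ LinearMap.lTensorHom H

@[simp] theorem mulTrd_tmul (t : Module.End k H) (a b c : H) :
    mulTrd k H t (a ⊗ₜ (b ⊗ₜ c)) = a ⊗ₜ (b * t c) := rfl

theorem mulTrd_smulRight (φ : Module.Dual k H) (y : H) :
    mulTrd k H (φ.smulRight y) = LinearMap.mulRight k (1 ⊗ₜ y) ∘ₗ evalTrd φ := by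
  ext a b c; simp

variable (k H) in
/-- The algebra homomorphism `f ⊗ a ↦ (v ⊗ x ↦ a v ⊗ f(x))`. -/
def endTmulHom : Module.End k H ⊗[k] H →ₐ[k] Module.End k (H ⊗[k] H) :=
  (Module.endTensorEndAlgHom (R := k) (S := k) (A := k) (M := H) (N := H)).comp
    ((Algebra.TensorProduct.map (Algebra.lmul k H) (AlgHom.id k (Module.End k H))).comp
      (Algebra.TensorProduct.comm k (Module.End k H) H).toAlgHom)

theorem endTmulHom_tmul (f : Module.End k H) (a : H) :
    endTmulHom k H (f ⊗ₜ a) = TensorProduct.map (LinearMap.mulLeft k a) f := rfl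

section Free

variable {k H : Type*} [CommRing k] [Ring H] [Algebra k H] [Module.Free k H] [Module.Finite k H]

theorem endTmulHom_injective : Function.Injective (endTmulHom k H) := by
  have hom_injective : Function.Injective (TensorProduct.homTensorHomMap (.id k) H H H H) := by
    rw [← homTensorHomEquiv_toLinearMap]
    exact (homTensorHomEquiv k H H H H).injective
  exact hom_injective.comp ((Module.Flat.rTensor_preserves_injective_linearMap _
    (Algebra.lmul_injective (R := k) (A := H))).comp
    (TensorProduct.comm k (Module.End k H) H).injective)

theorem finrank_range_endTmulHom [StrongRankCondition k] :
    Module.finrank k (LinearMap.range (endTmulHom k H).toLinearMap) =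
      Module.finrank k (H ⊗[k] (Module.Dual k H ⊗[k] H)) := by
  rw [LinearMap.finrank_range_of_inj endTmulHom_injective]
  simp only [Module.finrank_tensorProduct, Module.Dual, Module.finrank_linearMap,
    Module.finrank_self]
  ring

end Free

end TensorPower

namespace QuasiBialgebra

open TensorProduct

set_option maxSynthPendingDepth 6

variable {k H : Type*} [Field k] [Ring H] [Algebra k H] (Q : QuasiBialgebra k H)

/-- The inverse reassociator `Φ⁻¹`. -/
def reassocInv : H ⊗[k] (H ⊗[k] H) := ((Q.reassoc⁻¹ : (H ⊗[k] (H ⊗[k] H))ˣ) : H ⊗[k] (H ⊗[k] H))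

theorem reassoc_mul_inv : (Q.reassoc : H ⊗[k] (H ⊗[k] H)) * Q.reassocInv = 1 :=
  Q.reassoc.mul_inv

theorem reassoc_inv_mul : Q.reassocInv * (Q.reassoc : H ⊗[k] (H ⊗[k] H)) = 1 :=
  Q.reassoc.inv_mul

/-- `Δ ⊗ id` on `H ⊗ H`. -/
def comulLeft : H ⊗[k] H →ₐ[k] H ⊗[k] (H ⊗[k] H) :=
  (Algebra.TensorProduct.assoc k k k H H H).toAlgHom.comp
    (Algebra.TensorProduct.map Q.comul (AlgHom.id k H))

/-- `id ⊗ Δ` on `H ⊗ H`. -/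
def comulRight : H ⊗[k] H →ₐ[k] H ⊗[k] (H ⊗[k] H) :=
  Algebra.TensorProduct.map (AlgHom.id k H) Q.comul

/-- `Δ ⊗ id ⊗ id` on `H ⊗ H ⊗ H`. -/
def comulFst : H ⊗[k] (H ⊗[k] H) →ₐ[k] H ⊗[k] (H ⊗[k] (H ⊗[k] H)) :=
  (Algebra.TensorProduct.assoc k k k H H (H ⊗[k] H)).toAlgHom.comp
    (Algebra.TensorProduct.map Q.comul (AlgHom.id k (H ⊗[k] H)))

/-- `id ⊗ Δ ⊗ id` on `H ⊗ H ⊗ H`. -/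
def comulSnd : H ⊗[k] (H ⊗[k] H) →ₐ[k] H ⊗[k] (H ⊗[k] (H ⊗[k] H)) :=
  Algebra.TensorProduct.map (AlgHom.id k H) Q.comulLeft

/-- `id ⊗ id ⊗ Δ` on `H ⊗ H ⊗ H`. -/
def comulTrd : H ⊗[k] (H ⊗[k] H) →ₐ[k] H ⊗[k] (H ⊗[k] (H ⊗[k] H)) :=
  Algebra.TensorProduct.map (AlgHom.id k H) Q.comulRight

@[simp] theorem comulLeft_tmul (a b : H) :
    Q.comulLeft (a ⊗ₜ b) = TensorProduct.assoc k H H H (Q.comul a ⊗ₜ b) := rfl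

@[simp] theorem comulRight_tmul (a b : H) : Q.comulRight (a ⊗ₜ b) = a ⊗ₜ Q.comul b := rfl

@[simp] theorem comulFst_tmul (a : H) (w : H ⊗[k] H) :
    Q.comulFst (a ⊗ₜ w) = TensorProduct.assoc k H H (H ⊗[k] H) (Q.comul a ⊗ₜ w) := rfl

@[simp] theorem comulSnd_tmul (a : H) (w : H ⊗[k] H) :
    Q.comulSnd (a ⊗ₜ w) = a ⊗ₜ Q.comulLeft w := rfl

@[simp] theorem comulTrd_tmul (a : H) (w : H ⊗[k] H) :
    Q.comulTrd (a ⊗ₜ w) = a ⊗ₜ Q.comulRight w := rfl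

theorem comulRight_comul_mul_reassoc (h : H) :
    Q.comulRight (Q.comul h) * Q.reassoc = Q.reassoc * Q.comulLeft (Q.comul h) :=
  (Units.eq_mul_inv_iff_mul_eq _).mp (Q.quasi_coassoc h)

theorem reassocInv_mul_comulRight_comul (h : H) :
    Q.reassocInv * Q.comulRight (Q.comul h) = Q.comulLeft (Q.comul h) * Q.reassocInv := by
  rw [reassocInv, Units.inv_mul_eq_iff_eq_mul, ← mul_assoc]
  exact Q.quasi_coassoc h

section Pentagon

/-- `1 ⊗ Φ` as a unit. -/
def oneReassoc : (H ⊗[k] (H ⊗[k] (H ⊗[k] H)))ˣ :=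
  Units.map (Algebra.TensorProduct.includeRight :
    H ⊗[k] (H ⊗[k] H) →ₐ[k] H ⊗[k] (H ⊗[k] (H ⊗[k] H))).toMonoidHom Q.reassoc

theorem pentagon_units :
    Q.oneReassoc * Units.map Q.comulSnd.toMonoidHom Q.reassoc *
      Units.map (appendThree k H).toMonoidHom Q.reassoc =
    Units.map Q.comulTrd.toMonoidHom Q.reassoc * Units.map Q.comulFst.toMonoidHom Q.reassoc :=
  Units.ext <| by
    refine Eq.trans ?_ Q.pentagon
    exact congrArg (_ * ·) (appendThree_eq_assoc _)

theorem comulTrd_inv_mul :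
    Q.comulTrd Q.reassocInv * ((1 : H) ⊗ₜ[k] (Q.reassoc : H ⊗[k] (H ⊗[k] H))) =
      Q.comulFst Q.reassoc * appendThree k H Q.reassocInv * Q.comulSnd Q.reassocInv := by
  have units : (Units.map Q.comulTrd.toMonoidHom Q.reassoc)⁻¹ * Q.oneReassoc =
      Units.map Q.comulFst.toMonoidHom Q.reassoc *
        (Units.map (appendThree k H).toMonoidHom Q.reassoc)⁻¹ *
        (Units.map Q.comulSnd.toMonoidHom Q.reassoc)⁻¹ := by
    rw [eq_mul_inv_iff_mul_eq, eq_mul_inv_iff_mul_eq, mul_assoc, mul_assoc,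
      inv_mul_eq_iff_eq_mul, ← mul_assoc, pentagon_units]
  exact congrArg Units.val units

theorem appendThree_inv_mul_comulSnd_inv_mul :
    appendThree k H Q.reassocInv * Q.comulSnd Q.reassocInv * ((1 : H) ⊗ₜ[k] Q.reassocInv) =
      Q.comulFst Q.reassocInv * Q.comulTrd Q.reassocInv := by
  have units := congrArg Inv.inv Q.pentagon_units
  simp only [mul_inv_rev, ← mul_assoc] at units
  exact congrArg Units.val units

theorem comulFst_mul_appendThree_inv :
    Q.comulFst Q.reassoc * appendThree k H Q.reassocInv =
      Q.comulTrd Q.reassocInv * ((1 : H) ⊗ₜ[k] (Q.reassoc : H ⊗[k] (H ⊗[k] H))) *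
        Q.comulSnd Q.reassoc := by
  rw [comulTrd_inv_mul, mul_assoc _ (Q.comulSnd _) (Q.comulSnd _), ← map_mul, reassoc_inv_mul,
    map_one, mul_one]

end Pentagon

section Counit

variable {B N : Type*} [Ring B] [Algebra k B] [AddCommGroup N] [Module k N]

theorem map_reassocInv_eq_one (f : H ⊗[k] (H ⊗[k] H) →ₐ[k] B) (h : f Q.reassoc = 1) :
    f Q.reassocInv = 1 := by
  simpa [h] using congrArg f Q.reassoc_mul_inv

theorem counit_snd_inv : Algebra.TensorProduct.map (AlgHom.id k H)
    (Algebra.TensorProduct.map Q.counit (AlgHom.id k H)) Q.reassocInv = 1 :=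
  Q.map_reassocInv_eq_one _ Q.counit_snd

theorem counit_trd_inv : Algebra.TensorProduct.map (AlgHom.id k H)
    (Algebra.TensorProduct.map (AlgHom.id k H) Q.counit) Q.reassocInv = 1 :=
  Q.map_reassocInv_eq_one _ Q.counit_trd

theorem apply_mul_of_counit_fst {w : H ⊗[k] (H ⊗[k] H)}
    (hw : Algebra.TensorProduct.map Q.counit (AlgHom.id k (H ⊗[k] H)) w = 1)
    (f : H ⊗[k] (H ⊗[k] H) →ₐ[k] B) (G : B →ₗ[k] N)
    (hG : ∀ a y, G (f (a ⊗ₜ 1) * y) = Q.counit a • G y) (y : B) : G (f w * y) = G y := by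
  have key (v : H ⊗[k] (H ⊗[k] H)) : G (f v * y) = G (f (Algebra.TensorProduct.includeRight
      (Algebra.TensorProduct.lid k _
        (Algebra.TensorProduct.map Q.counit (AlgHom.id k (H ⊗[k] H)) v))) * y) := by
    induction v with
    | zero => simp
    | add u v hu hv => simp only [map_add, add_mul, hu, hv]
    | tmul a u =>
      have split : a ⊗ₜ[k] u = (a ⊗ₜ 1) * ((1 : H) ⊗ₜ u) := by simp
      rw [split, map_mul f, mul_assoc, hG]
      simp
  rw [key, hw, map_one, map_one, map_one, one_mul]

theorem apply_mul_of_counit_trd {w : H ⊗[k] (H ⊗[k] H)}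
    (hw : Algebra.TensorProduct.map (AlgHom.id k H)
      (Algebra.TensorProduct.map (AlgHom.id k H) Q.counit) w = 1)
    (f : H ⊗[k] (H ⊗[k] H) →ₐ[k] B) (G : B →ₗ[k] N)
    (hG : ∀ c y, G (f (1 ⊗ₜ (1 ⊗ₜ c)) * y) = Q.counit c • G y) (y : B) : G (f w * y) = G y := by
  have key (v : H ⊗[k] (H ⊗[k] H)) : G (f v * y) = G (f (Algebra.TensorProduct.map
      (AlgHom.id k H) (Algebra.TensorProduct.map (AlgHom.id k H) (Algebra.ofId k H))
        (Algebra.TensorProduct.map (AlgHom.id k H)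
          (Algebra.TensorProduct.map (AlgHom.id k H) Q.counit) v)) * y) := by
    induction v using tensor_induction_three with
    | zero => simp
    | add u v hu hv => simp only [map_add, add_mul, hu, hv]
    | tmul a b c =>
      have split : a ⊗ₜ[k] (b ⊗ₜ[k] c) = ((1 : H) ⊗ₜ ((1 : H) ⊗ₜ c)) * (a ⊗ₜ (b ⊗ₜ 1)) := by simp
      rw [split, map_mul f, mul_assoc, hG]
      simp [Algebra.ofId_apply, Algebra.algebraMap_eq_smul_one]
  rw [key, hw, map_one, map_one, one_mul]

theorem apply_mul_of_counit_snd {w : H ⊗[k] (H ⊗[k] H)}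
    (hw : Algebra.TensorProduct.map (AlgHom.id k H)
      (Algebra.TensorProduct.map Q.counit (AlgHom.id k H)) w = 1)
    (f : H ⊗[k] (H ⊗[k] H) →ₐ[k] B) (G : B →ₗ[k] N)
    (hG : ∀ b y, G (y * f (1 ⊗ₜ (b ⊗ₜ 1))) = Q.counit b • G y) (y : B) : G (y * f w) = G y := by
  have key (v : H ⊗[k] (H ⊗[k] H)) : G (y * f v) = G (y * f (Algebra.TensorProduct.map
      (AlgHom.id k H) (Algebra.TensorProduct.map (Algebra.ofId k H) (AlgHom.id k H))
        (Algebra.TensorProduct.map (AlgHom.id k H)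
          (Algebra.TensorProduct.map Q.counit (AlgHom.id k H)) v))) := by
    induction v using tensor_induction_three with
    | zero => simp
    | add u v hu hv => simp only [map_add, mul_add, hu, hv]
    | tmul a b c =>
      have split : a ⊗ₜ[k] (b ⊗ₜ[k] c) = (a ⊗ₜ (1 ⊗ₜ c)) * ((1 : H) ⊗ₜ (b ⊗ₜ (1 : H))) := by simp
      rw [split, map_mul f, ← mul_assoc, hG]
      simp [Algebra.ofId_apply, Algebra.algebraMap_eq_smul_one, ← smul_tmul']
  rw [key, hw, map_one, map_one, mul_one]

theorem apply_comul_of_counit_fst (G : H ⊗[k] H →ₗ[k] N) (F : H →ₗ[k] N)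
    (hG : ∀ a b, G (a ⊗ₜ b) = Q.counit a • F b) (h : H) : G (Q.comul h) = F h := by
  have key : G = F ∘ₗ (TensorProduct.lid k H).toLinearMap ∘ₗ
      (Algebra.TensorProduct.map Q.counit (AlgHom.id k H)).toLinearMap := by
    ext a b; simp [hG]
  rw [key]
  exact congrArg (F ∘ TensorProduct.lid k H) (Q.counit_id_comul h) |>.trans (by simp)

theorem apply_comul_of_counit_snd (G : H ⊗[k] H →ₗ[k] N) (F : H →ₗ[k] N)
    (hG : ∀ a b, G (a ⊗ₜ b) = Q.counit b • F a) (h : H) : G (Q.comul h) = F h := by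
  have key : G = F ∘ₗ (TensorProduct.rid k H).toLinearMap ∘ₗ
      (Algebra.TensorProduct.map (AlgHom.id k H) Q.counit).toLinearMap := by
    ext a b; simp [hG]
  rw [key]
  exact congrArg (F ∘ TensorProduct.rid k H) (Q.id_counit_comul h) |>.trans (by simp)

/-- `id ⊗ ε` on `H ⊗ H`. -/
def counitSnd : H ⊗[k] H →ₐ[k] H :=
  (Algebra.TensorProduct.rid k k H).toAlgHom.comp
    (Algebra.TensorProduct.map (AlgHom.id k H) Q.counit)

@[simp] theorem counitSnd_tmul (a b : H) : Q.counitSnd (a ⊗ₜ b) = Q.counit b • a := rfl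

@[simp] theorem counitSnd_comul (h : H) : Q.counitSnd (Q.comul h) = h :=
  Q.apply_comul_of_counit_snd Q.counitSnd.toLinearMap LinearMap.id (fun _ _ => rfl) h

/-- `id ⊗ ε ⊗ id` on `H ⊗ H ⊗ H`. -/
def counitMid : H ⊗[k] (H ⊗[k] H) →ₐ[k] H ⊗[k] H :=
  (Algebra.TensorProduct.map (AlgHom.id k H) (Algebra.TensorProduct.lid k H).toAlgHom).comp
    (Algebra.TensorProduct.map (AlgHom.id k H) (Algebra.TensorProduct.map Q.counit (AlgHom.id k H)))

@[simp] theorem counitMid_tmul (a b c : H) :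
    Q.counitMid (a ⊗ₜ (b ⊗ₜ c)) = a ⊗ₜ (Q.counit b • c) := rfl

theorem counitMid_reassocInv : Q.counitMid Q.reassocInv = 1 := by
  rw [counitMid, AlgHom.comp_apply, counit_snd_inv, map_one]

theorem counitMid_comulRight (m : H ⊗[k] H) : Q.counitMid (Q.comulRight m) = m := by
  induction m with
  | zero => simp
  | add u v hu hv => simp only [map_add, hu, hv]
  | tmul a b =>
    exact Q.apply_comul_of_counit_fst (Q.counitMid.toLinearMap ∘ₗ TensorProduct.mk k H _ a)
      (TensorProduct.mk k H H a) (fun b c => by simp) b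

end Counit

section Coaction

theorem comulLeft_tmul_one (a : H) : Q.comulLeft (a ⊗ₜ 1) = appendTwo k H (Q.comul a) := by
  rw [comulLeft_tmul, appendTwo_eq_assoc]
  rfl

/-- The iterated coproduct `(Δ ⊗ id) ∘ Δ`. -/
def comulThree : H →ₐ[k] H ⊗[k] (H ⊗[k] H) := Q.comulLeft.comp Q.comul

/-- The map `m ↦ Φ⁻¹ (id ⊗ Δ)(m)`, through which `H*` acts on `H ⊗ H`. -/
def coaction : H ⊗[k] H →ₗ[k] H ⊗[k] (H ⊗[k] H) :=
  LinearMap.mulLeft k Q.reassocInv ∘ₗ Q.comulRight.toLinearMap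

theorem coaction_apply (m : H ⊗[k] H) : Q.coaction m = Q.reassocInv * Q.comulRight m := rfl

theorem reassoc_mul_coaction (m : H ⊗[k] H) :
    (Q.reassoc : H ⊗[k] (H ⊗[k] H)) * Q.coaction m = Q.comulRight m := by
  rw [coaction_apply, ← mul_assoc, reassoc_mul_inv, one_mul]

theorem counitMid_coaction (m : H ⊗[k] H) : Q.counitMid (Q.coaction m) = m := by
  rw [coaction_apply, map_mul, counitMid_reassocInv, counitMid_comulRight, one_mul]

theorem coaction_mul (m n : H ⊗[k] H) : Q.coaction (m * n) = Q.coaction m * Q.comulRight n := by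
  rw [coaction_apply, map_mul, ← mul_assoc, ← coaction_apply]

theorem coaction_comul_mul (h : H) (m : H ⊗[k] H) :
    Q.coaction (Q.comul h * m) = Q.comulThree h * Q.coaction m := by
  rw [coaction_apply, map_mul, ← mul_assoc, reassocInv_mul_comulRight_comul, mul_assoc]; rfl

theorem coaction_tmul_one (t : H ⊗[k] H) (a : H) :
    Q.coaction (t * a ⊗ₜ 1) = Q.coaction t * a ⊗ₜ 1 := by
  rw [coaction_mul, comulRight_tmul, map_one]

theorem comulFst_appendTwo (v : H ⊗[k] H) :
    Q.comulFst (appendTwo k H v) = appendThree k H (Q.comulLeft v) := by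
  induction v with
  | zero => simp
  | add u v hu hv => simp only [map_add, hu, hv]
  | tmul a b =>
    rw [appendTwo_tmul, comulFst_tmul, comulLeft_tmul]
    induction Q.comul a with
    | zero => simp
    | add u v hu hv => simp only [add_tmul, map_add, hu, hv]
    | tmul x y => rfl

theorem comulSnd_appendTwo (v : H ⊗[k] H) :
    Q.comulSnd (appendTwo k H v) = appendThree k H (Q.comulRight v) := by
  induction v with
  | zero => simp
  | add u v hu hv => simp only [map_add, hu, hv]
  | tmul a b => rw [appendTwo_tmul, comulSnd_tmul, comulLeft_tmul_one]; rfl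

theorem one_tmul_reassocInv_mul_comulTrd_comulRight (m : H ⊗[k] H) :
    (1 : H) ⊗ₜ[k] Q.reassocInv * Q.comulTrd (Q.comulRight m) =
      Q.comulSnd (Q.comulRight m) * 1 ⊗ₜ Q.reassocInv := by
  induction m with
  | zero => simp
  | add u v hu hv => simp only [add_mul, mul_add, map_add, hu, hv]
  | tmul a b => simp [reassocInv_mul_comulRight_comul]

theorem comulFst_reassocInv_mul_comulTrd_coaction (m : H ⊗[k] H) :
    Q.comulFst Q.reassocInv * (Q.comulTrd (Q.coaction m) *
      (1 : H) ⊗ₜ[k] (Q.reassoc : H ⊗[k] (H ⊗[k] H))) =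
    appendThree k H Q.reassocInv * Q.comulSnd (Q.coaction m) := by
  have cancel : (1 : H) ⊗ₜ[k] Q.reassocInv * (1 : H) ⊗ₜ[k] (Q.reassoc : H ⊗[k] (H ⊗[k] H)) = 1 := by
    rw [Algebra.TensorProduct.tmul_mul_tmul, reassoc_inv_mul, mul_one,
      ← Algebra.TensorProduct.one_def]
  rw [coaction_apply, map_mul, map_mul, ← mul_assoc, ← mul_assoc, ← mul_assoc,
    ← appendThree_inv_mul_comulSnd_inv_mul, mul_assoc _ (1 ⊗ₜ[k] Q.reassocInv),
    one_tmul_reassocInv_mul_comulTrd_comulRight, mul_assoc, mul_assoc _ (1 ⊗ₜ[k] Q.reassocInv),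
    cancel, mul_one, mul_assoc]

theorem comulFst_leftLeg_mul (h h' : H) (m : H ⊗[k] H) :
    Q.comulFst (Q.leftLeg h h') * (Q.comulTrd (Q.coaction m) *
      (1 : H) ⊗ₜ[k] (Q.reassoc : H ⊗[k] (H ⊗[k] H))) =
    appendThree k H (appendTwo k H (Q.comul h) * Q.reassocInv) *
      Q.comulSnd (appendTwo k H (Q.comul h') * Q.coaction m) := by
  have leftLeg_eq : Q.leftLeg h h' =
      appendTwo k H (h ⊗ₜ 1) * appendTwo k H (Q.comul h') * Q.reassocInv := by
    rw [← comulLeft_tmul_one]; rfl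
  rw [leftLeg_eq, map_mul, mul_assoc, comulFst_reassocInv_mul_comulTrd_coaction, ← mul_assoc,
    map_mul, comulFst_appendTwo, comulFst_appendTwo, mul_assoc (appendThree k H _), ← map_mul,
    ← reassocInv_mul_comulRight_comul, map_mul, map_mul, map_mul, comulSnd_appendTwo,
    comulLeft_tmul_one]
  simp only [mul_assoc]

end Coaction

section Evaluation

theorem evalTrd_mul_one_tmul (φ : Module.Dual k H) (w : H ⊗[k] (H ⊗[k] H)) (b c : H) :
    evalTrd φ (w * 1 ⊗ₜ (b ⊗ₜ c)) = evalTrd (regL k H c φ) w * 1 ⊗ₜ b := by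
  induction w using tensor_induction_three with
  | zero => simp
  | add x y hx hy => simp only [add_mul, map_add, hx, hy]
  | tmul x y z => simp

theorem lTensor_evalTrd_comulSnd (ψ : Module.Dual k H) (w : H ⊗[k] (H ⊗[k] H)) :
    LinearMap.lTensor H (evalTrd ψ) (Q.comulSnd w) = Q.comulRight (evalTrd ψ w) := by
  induction w using tensor_induction_three with
  | zero => simp
  | add x y hx hy => simp only [map_add, hx, hy]
  | tmul a b c =>
    rw [comulSnd_tmul, comulLeft_tmul, evalTrd_tmul, map_smul, comulRight_tmul]
    induction Q.comul b with
    | zero => simp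
    | add x y hx hy => simp only [add_tmul, tmul_add, map_add, hx, hy, smul_add]
    | tmul x y => simp

theorem coaction_evalTrd (ψ : Module.Dual k H) (w : H ⊗[k] (H ⊗[k] H)) :
    Q.coaction (evalTrd ψ w) =
      LinearMap.lTensor H (evalTrd ψ) (appendThree k H Q.reassocInv * Q.comulSnd w) := by
  rw [lTensor_evalTrd_appendThree_mul, lTensor_evalTrd_comulSnd, coaction_apply]

theorem evalTrdFth_comulTrd (φ ψ : Module.Dual k H) (w : H ⊗[k] (H ⊗[k] H)) :
    evalTrdFth φ ψ (Q.comulTrd w) = evalTrd (Q.conv φ ψ) w := by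
  induction w using tensor_induction_three with
  | zero => simp
  | add x y hx hy => simp only [map_add, hx, hy]
  | tmul a b c =>
    rw [comulTrd_tmul, comulRight_tmul, evalTrd_tmul, conv_apply]
    induction Q.comul c with
    | zero => simp
    | add x y hx hy => simp only [tmul_add, map_add, hx, hy, add_smul]
    | tmul x y => simp

theorem evalTrdFth_comulFst_mul_mul (φ ψ : Module.Dual k H) (u₁ u₂ u₃ w₁ w₂ : H)
    (y : H ⊗[k] (H ⊗[k] (H ⊗[k] H))) :
    evalTrdFth φ ψ (Q.comulFst (u₁ ⊗ₜ (u₂ ⊗ₜ u₃)) * (y * 1 ⊗ₜ (1 ⊗ₜ (w₁ ⊗ₜ w₂)))) =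
      Q.comul u₁ * evalTrdFth (regL k H w₁ (regR k H u₂ φ)) (regL k H w₂ (regR k H u₃ ψ)) y := by
  have split : Q.comulFst (u₁ ⊗ₜ (u₂ ⊗ₜ u₃)) =
      appendThree k H (appendTwo k H (Q.comul u₁)) * 1 ⊗ₜ (1 ⊗ₜ (u₂ ⊗ₜ u₃)) := by
    rw [comulFst_tmul]
    induction Q.comul u₁ with
    | zero => simp
    | add x y hx hy => simp only [add_tmul, map_add, add_mul, hx, hy]
    | tmul x y => simp
  rw [split, mul_assoc, evalTrdFth, LinearMap.comp_apply, lTensor_evalTrd_appendThree_mul,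
    evalTrd_appendTwo_mul]
  congr 1
  induction y using tensor_induction_four with
  | zero => simp
  | add x y hx hy => simp only [mul_add, add_mul, map_add, hx, hy]
  | tmul a b c d => simp [smul_smul, mul_comm]

theorem evalTrd_counit (w : H ⊗[k] (H ⊗[k] H)) :
    evalTrd Q.counit.toLinearMap w =
      Algebra.TensorProduct.map (AlgHom.id k H) Q.counitSnd w := rfl

end Evaluation

end QuasiBialgebra

namespace QuasiHopfAlgebra

open TensorProduct QuasiBialgebra

set_option maxSynthPendingDepth 6

variable {k H : Type*} [Field k] [Ring H] [Algebra k H] (Q : QuasiHopfAlgebra k H)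

section Antipode

/-- The antipode `S` as a linear map. -/
def S : H →ₗ[k] H := antiLin Q.antipode

/-- The inverse antipode `S⁻¹` as a linear map. -/
def sinv : H →ₗ[k] H :=
  Q.antipode.symm.toLinearMap ∘ₗ (MulOpposite.opLinearEquiv k : H ≃ₗ[k] Hᵐᵒᵖ).toLinearMap

theorem S_mul (a b : H) : Q.S (a * b) = Q.S b * Q.S a :=
  congrArg MulOpposite.unop (map_mul Q.antipode a b)

theorem sinv_mul (a b : H) : Q.sinv (a * b) = Q.sinv b * Q.sinv a :=
  map_mul Q.antipode.symm (MulOpposite.op b) (MulOpposite.op a)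

theorem sinv_one : Q.sinv 1 = 1 := map_one Q.antipode.symm

theorem sinv_S (a : H) : Q.sinv (Q.S a) = a := Q.antipode.symm_apply_apply a

/-- The evaluation `a ⊗ b ↦ S(a) α b`. -/
def ev : H ⊗[k] H →ₗ[k] H :=
  LinearMap.mul' k H ∘ₗ TensorProduct.map (LinearMap.mulRight k Q.alpha ∘ₗ Q.S) LinearMap.id

/-- The coevaluation `a ⊗ b ↦ a β S(b)`. -/
def coev : H ⊗[k] H →ₗ[k] H :=
  LinearMap.mul' k H ∘ₗ TensorProduct.map (LinearMap.mulRight k Q.beta) Q.S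

/-- `a ⊗ b ⊗ c ↦ a β S(b) α c`, whose value at `Φ` is one of the two zigzag identities. -/
def zigzag : H ⊗[k] (H ⊗[k] H) →ₗ[k] H :=
  LinearMap.mul' k H ∘ₗ TensorProduct.map (LinearMap.mulRight k Q.beta) Q.ev

/-- `a ⊗ b ⊗ c ↦ S(a) α b β S(c)`, whose value at `Φ⁻¹` is the other zigzag identity. -/
def zagzig : H ⊗[k] (H ⊗[k] H) →ₗ[k] H :=
  LinearMap.mul' k H ∘ₗ TensorProduct.map (LinearMap.mulRight k Q.alpha ∘ₗ Q.S) Q.coev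

@[simp] theorem ev_tmul (a b : H) : Q.ev (a ⊗ₜ b) = Q.S a * Q.alpha * b := rfl

@[simp] theorem coev_tmul (a b : H) : Q.coev (a ⊗ₜ b) = a * Q.beta * Q.S b := rfl

@[simp] theorem zigzag_tmul (a : H) (w : H ⊗[k] H) :
    Q.zigzag (a ⊗ₜ w) = a * Q.beta * Q.ev w := rfl

@[simp] theorem zagzig_tmul (a : H) (w : H ⊗[k] H) :
    Q.zagzig (a ⊗ₜ w) = Q.S a * Q.alpha * Q.coev w := rfl

theorem zigzag_reassoc : Q.zigzag Q.reassoc = 1 := Q.reassoc_antipode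

theorem zagzig_reassocInv : Q.zagzig Q.reassocInv = 1 := Q.reassoc_inv_antipode

theorem ev_mul_tmul (w : H ⊗[k] H) (a b : H) : Q.ev (w * a ⊗ₜ b) = Q.S a * Q.ev w * b := by
  induction w with
  | zero => simp
  | add u v hu hv => simp only [add_mul, map_add, hu, hv, mul_add]
  | tmul c d => simp [S_mul, mul_assoc]

theorem coev_tmul_mul (a b : H) (w : H ⊗[k] H) : Q.coev (a ⊗ₜ b * w) = a * Q.coev w * Q.S b := by
  induction w with
  | zero => simp
  | add u v hu hv => simp only [add_mul, map_add, hu, hv, mul_add]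
  | tmul c d => simp [S_mul, mul_assoc]

theorem ev_comul_mul (h : H) (w : H ⊗[k] H) : Q.ev (Q.comul h * w) = Q.counit h • Q.ev w := by
  induction w with
  | zero => simp
  | add u v hu hv => simp only [mul_add, map_add, hu, hv, smul_add]
  | tmul a b =>
    have counit : Q.ev (Q.comul h) = Q.counit h • Q.alpha := Q.antipode_alpha h
    simp [ev_mul_tmul, counit]

theorem coev_mul_comul (w : H ⊗[k] H) (h : H) :
    Q.coev (w * Q.comul h) = Q.counit h • Q.coev w := by
  induction w with
  | zero => simp
  | add u v hu hv => simp only [add_mul, map_add, hu, hv, smul_add]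
  | tmul a b =>
    have counit : Q.coev (Q.comul h) = Q.counit h • Q.beta := Q.beta_antipode h
    simp [coev_tmul_mul, counit]

theorem zigzag_assoc_tmul (w : H ⊗[k] H) (c : H) :
    Q.zigzag (TensorProduct.assoc k H H H (w ⊗ₜ c)) = Q.coev w * Q.alpha * c := by
  induction w with
  | zero => simp
  | add u v hu hv => simp only [add_tmul, map_add, hu, hv, add_mul]
  | tmul a b => simp [mul_assoc]

/-- The element `S⁻¹(α)`. -/
def alphaInv : H := Q.sinv Q.alpha

theorem sinv_ev_tmul (a b : H) : Q.sinv (Q.ev (a ⊗ₜ b)) = Q.sinv b * Q.alphaInv * a := by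
  simp [sinv_mul, sinv_S, alphaInv, mul_assoc]

/-- The zigzag identity for `Φ` exhibits `1` in the two-sided ideal generated by `S⁻¹(α)`. -/
theorem one_mem_of_alphaInv_mem {p : Submodule k H} (alphaInv_mem : Q.alphaInv ∈ p)
    (sinv_mul_mem : ∀ c, ∀ r ∈ p, Q.sinv c * r ∈ p) (mul_mem : ∀ c, ∀ r ∈ p, r * c ∈ p) :
    (1 : H) ∈ p := by
  have key (w : H ⊗[k] (H ⊗[k] H)) : Q.sinv (Q.zigzag w) ∈ p := by
    induction w using tensor_induction_three with
    | zero => simp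
    | add u v hu hv => simpa only [map_add] using add_mem hu hv
    | tmul a b c =>
      rw [zigzag_tmul, sinv_mul, sinv_ev_tmul]
      exact mul_mem _ _ (mul_mem _ _ (sinv_mul_mem _ _ alphaInv_mem))
  simpa [zigzag_reassoc, sinv_one] using key Q.reassoc

end Antipode

section RightAction

variable {A B : Type*} [Ring A] [Algebra k A] [Ring B] [Algebra k B]

/-- The right action `t ◁ (a ⊗ c) = F(S⁻¹(c)) t a` of `A ⊗ H` on an algebra `A` with an algebra
homomorphism `F : H → A`, restricted along `e : B → A ⊗ H` (in practice a rebracketing). -/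
def rightSMul (e : B →ₐ[k] A ⊗[k] H) (F : H →ₐ[k] A) : A →ₗ[k] B →ₗ[k] A :=
  LinearMap.mk₂ k
    (fun t b => LinearMap.mul' k A (TensorProduct.map (F.toLinearMap ∘ₗ Q.sinv)
      (LinearMap.mul k A t) (TensorProduct.comm k A H (e b))))
    (by intros; simp [TensorProduct.map_add_right])
    (by intros; simp [TensorProduct.map_smul_right])
    (by intros; simp)
    (by intros; simp)

theorem rightSMul_of_eq_tmul {e : B →ₐ[k] A ⊗[k] H} {b : B} {a : A} {c : H}
    (h : e b = a ⊗ₜ c) (F : H →ₐ[k] A) (t : A) :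
    Q.rightSMul e F t b = F (Q.sinv c) * (t * a) := by
  simp [rightSMul, h]

theorem rightSMul_one (e : B →ₐ[k] A ⊗[k] H) (F : H →ₐ[k] A) (t : A) :
    Q.rightSMul e F t 1 = t := by
  rw [Q.rightSMul_of_eq_tmul (map_one e), sinv_one, map_one, one_mul, mul_one]

theorem rightSMul_mul (e : B →ₐ[k] A ⊗[k] H) (F : H →ₐ[k] A) (t : A) (v w : B) :
    Q.rightSMul e F t (v * w) = Q.rightSMul e F (Q.rightSMul e F t v) w := by
  simp only [rightSMul, LinearMap.mk₂_apply, map_mul]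
  generalize e v = x, e w = y
  induction y with
  | zero => simp
  | add y z hy hz => simp only [mul_add, map_add, hy, hz]
  | tmul a c =>
    induction x with
    | zero => simp
    | add x z hx hz => simp only [add_mul, map_add, hx, hz, map_add_right, LinearMap.add_apply]
    | tmul a' c' => simp [sinv_mul, mul_assoc]

/-- The action `t ◁ (a ⊗ b ⊗ c) = Δ(S⁻¹(c)) t (a ⊗ b)` of `H ⊗ H ⊗ H` on `H ⊗ H`. -/
def smulTwo : H ⊗[k] H →ₗ[k] H ⊗[k] (H ⊗[k] H) →ₗ[k] H ⊗[k] H :=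
  Q.rightSMul (Algebra.TensorProduct.assoc k k k H H H).symm.toAlgHom Q.comul

/-- The action `t ◁ (a ⊗ b ⊗ c ⊗ d) = (Δ ⊗ id)(Δ(S⁻¹(d))) t (a ⊗ b ⊗ c)` of
`H ⊗ H ⊗ H ⊗ H` on `H ⊗ H ⊗ H`. -/
def smulThree :
    H ⊗[k] (H ⊗[k] H) →ₗ[k] H ⊗[k] (H ⊗[k] (H ⊗[k] H)) →ₗ[k] H ⊗[k] (H ⊗[k] H) :=
  Q.rightSMul ((Algebra.TensorProduct.assoc k k k H (H ⊗[k] H) H).symm.toAlgHom.comp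
    (Algebra.TensorProduct.map (AlgHom.id k H)
      (Algebra.TensorProduct.assoc k k k H H H).symm.toAlgHom)) Q.comulThree

theorem smulTwo_one (t : H ⊗[k] H) : Q.smulTwo t 1 = t := Q.rightSMul_one _ _ t

theorem smulTwo_mul (t : H ⊗[k] H) (v w : H ⊗[k] (H ⊗[k] H)) :
    Q.smulTwo t (v * w) = Q.smulTwo (Q.smulTwo t v) w := Q.rightSMul_mul _ _ t v w

theorem smulThree_mul (t : H ⊗[k] (H ⊗[k] H)) (v w : H ⊗[k] (H ⊗[k] (H ⊗[k] H))) :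
    Q.smulThree t (v * w) = Q.smulThree (Q.smulThree t v) w := Q.rightSMul_mul _ _ t v w

theorem smulTwo_assoc_tmul (t w : H ⊗[k] H) (c : H) :
    Q.smulTwo t (TensorProduct.assoc k H H H (w ⊗ₜ c)) = Q.comul (Q.sinv c) * (t * w) :=
  Q.rightSMul_of_eq_tmul ((TensorProduct.assoc k H H H).symm_apply_apply _) _ t

theorem smulThree_tmul_assoc_tmul (t : H ⊗[k] (H ⊗[k] H)) (a : H) (w : H ⊗[k] H) (d : H) :
    Q.smulThree t (a ⊗ₜ TensorProduct.assoc k H H H (w ⊗ₜ d)) =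
      Q.comulThree (Q.sinv d) * (t * a ⊗ₜ w) :=
  Q.rightSMul_of_eq_tmul (a := a ⊗ₜ w) (c := d) (congrArg
    (fun v => (TensorProduct.assoc k H (H ⊗[k] H) H).symm (a ⊗ₜ v))
    ((TensorProduct.assoc k H H H).symm_apply_apply (w ⊗ₜ d))) _ t

@[simp] theorem smulTwo_tmul (t : H ⊗[k] H) (a b c : H) :
    Q.smulTwo t (a ⊗ₜ (b ⊗ₜ c)) = Q.comul (Q.sinv c) * (t * a ⊗ₜ b) :=
  Q.smulTwo_assoc_tmul t (a ⊗ₜ b) c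

@[simp] theorem smulThree_tmul (t : H ⊗[k] (H ⊗[k] H)) (a b c d : H) :
    Q.smulThree t (a ⊗ₜ (b ⊗ₜ (c ⊗ₜ d))) =
      Q.comulThree (Q.sinv d) * (t * a ⊗ₜ (b ⊗ₜ c)) :=
  Q.smulThree_tmul_assoc_tmul t a (b ⊗ₜ c) d

theorem smulTwo_appendTwo (t w : H ⊗[k] H) : Q.smulTwo t (appendTwo k H w) = t * w := by
  induction w with
  | zero => simp
  | add u v hu hv => simp only [map_add, mul_add, hu, hv]
  | tmul a b => simp [sinv_one]

theorem smulThree_appendThree (t w : H ⊗[k] (H ⊗[k] H)) :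
    Q.smulThree t (appendThree k H w) = t * w := by
  induction w using tensor_induction_three with
  | zero => simp
  | add u v hu hv => simp only [map_add, mul_add, hu, hv]
  | tmul a b c => simp [sinv_one]

theorem smulTwo_mul_tmul_one (t v : H ⊗[k] H) (r : H) :
    Q.smulTwo t (1 ⊗ₜ v) * r ⊗ₜ 1 = Q.smulTwo (t * r ⊗ₜ 1) (1 ⊗ₜ v) := by
  rw [← smulTwo_appendTwo, ← smulTwo_appendTwo, ← smulTwo_mul, ← smulTwo_mul]
  simp [← Algebra.TensorProduct.one_def]

theorem smulThree_mul_tmul_one (t v : H ⊗[k] (H ⊗[k] H)) (r : H) :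
    Q.smulThree t (1 ⊗ₜ v) * r ⊗ₜ 1 = Q.smulThree (t * r ⊗ₜ 1) (1 ⊗ₜ v) := by
  rw [← smulThree_appendThree, ← smulThree_appendThree, ← smulThree_mul, ← smulThree_mul]
  simp

theorem smulTwo_comul_alphaInv_comulLeft (w : H ⊗[k] H) :
    Q.smulTwo (Q.comul Q.alphaInv) (Q.comulLeft w) = Q.comul (Q.sinv (Q.ev w)) := by
  induction w with
  | zero => simp
  | add u v hu hv => simp only [map_add, hu, hv]
  | tmul a b => rw [comulLeft_tmul, smulTwo_assoc_tmul, sinv_ev_tmul, ← map_mul, ← map_mul,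
      mul_assoc]

theorem comulLeft_smulTwo (t : H ⊗[k] H) (w : H ⊗[k] (H ⊗[k] H)) :
    Q.comulLeft (Q.smulTwo t w) = Q.smulThree (Q.comulLeft t) (Q.comulFst w) := by
  induction w using tensor_induction_three with
  | zero => simp
  | add u v hu hv => simp only [map_add, hu, hv]
  | tmul a b c =>
    rw [smulTwo_tmul, map_mul, map_mul, comulLeft_tmul, comulFst_tmul]
    generalize Q.comul a = d
    induction d with
    | zero => simp
    | add u v hu hv => simp only [add_tmul, map_add, mul_add, hu, hv]
    | tmul x y => simp [comulThree]

theorem coaction_smulTwo (t : H ⊗[k] H) (w : H ⊗[k] (H ⊗[k] H)) :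
    Q.coaction (Q.smulTwo t w) = Q.smulThree (Q.coaction t) (Q.comulSnd w) := by
  induction w using tensor_induction_three with
  | zero => simp
  | add u v hu hv => simp only [map_add, hu, hv]
  | tmul a b c =>
    rw [smulTwo_tmul, coaction_comul_mul, coaction_mul, comulRight_tmul, comulSnd_tmul,
      comulLeft_tmul, smulThree_tmul_assoc_tmul]

end RightAction

section Twist

/-- The element `γ = Δ(S⁻¹(α)) ◁ Φ⁻¹`, the twisted form of `Δ(S⁻¹(α))`. -/
def gamma : H ⊗[k] H := Q.smulTwo (Q.comul Q.alphaInv) Q.reassocInv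

theorem smulTwo_gamma_comulRight_comul (h : H) :
    Q.smulTwo Q.gamma (Q.comulRight (Q.comul h)) = Q.counit h • Q.gamma := by
  have ev_comul : Q.ev (Q.comul h) = Q.counit h • Q.alpha := Q.antipode_alpha h
  rw [gamma, ← smulTwo_mul, reassocInv_mul_comulRight_comul, smulTwo_mul,
    smulTwo_comul_alphaInv_comulLeft, ev_comul, map_smul, map_smul, map_smul,
    LinearMap.smul_apply, alphaInv]

/-- `a ⊗ b ⊗ c ↦ (γ ◁ (b ⊗ Δ(c))) (S⁻¹(β) S⁻¹(a) ⊗ 1)`, whose value at `Φ` is the twist. -/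
def preTwist : H ⊗[k] (H ⊗[k] H) →ₗ[k] H ⊗[k] H :=
  LinearMap.mul' k (H ⊗[k] H) ∘ₗ
    TensorProduct.map (Q.smulTwo Q.gamma ∘ₗ Q.comulRight.toLinearMap)
      ((Algebra.TensorProduct.includeLeft : H →ₐ[k] H ⊗[k] H).toLinearMap ∘ₗ
        LinearMap.mulLeft k (Q.sinv Q.beta) ∘ₗ Q.sinv) ∘ₗ
    (TensorProduct.comm k H (H ⊗[k] H)).toLinearMap

theorem preTwist_tmul (a : H) (v : H ⊗[k] H) :
    Q.preTwist (a ⊗ₜ v) =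
      Q.smulTwo Q.gamma (Q.comulRight v) * (Q.sinv Q.beta * Q.sinv a) ⊗ₜ 1 := rfl

theorem preTwist_assoc_tmul (w : H ⊗[k] H) (c : H) :
    Q.preTwist (TensorProduct.assoc k H H H (w ⊗ₜ c)) =
      Q.smulTwo Q.gamma (1 ⊗ₜ Q.comul c) * Q.sinv (Q.coev w) ⊗ₜ 1 := by
  induction w with
  | zero => simp
  | add u v hu hv => simp only [add_tmul, map_add, hu, hv, mul_add]
  | tmul a b =>
    have split : Q.comulRight (b ⊗ₜ c) = 1 ⊗ₜ Q.comul c * appendTwo k H (b ⊗ₜ 1) := by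
      simp [← Algebra.TensorProduct.one_def]
    rw [assoc_tmul, preTwist_tmul, split, smulTwo_mul, smulTwo_appendTwo, mul_assoc]
    simp [sinv_mul, sinv_S, mul_assoc]

theorem preTwist_mul_comulLeft_tmul (w : H ⊗[k] (H ⊗[k] H)) (a b : H) :
    Q.preTwist (w * Q.comulLeft (a ⊗ₜ b)) =
      Q.counit a • Q.smulTwo (Q.preTwist w) (1 ⊗ₜ Q.comul b) := by
  obtain ⟨w, rfl⟩ := (Algebra.TensorProduct.assoc k k k H H H).surjective w
  induction w with
  | zero => simp
  | add u v hu hv => simp only [map_add, add_mul, hu, hv, smul_add, LinearMap.add_apply]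
  | tmul w c =>
    have regroup : Algebra.TensorProduct.assoc k k k H H H (w ⊗ₜ c) * Q.comulLeft (a ⊗ₜ b) =
        TensorProduct.assoc k H H H ((w * Q.comul a) ⊗ₜ (c * b)) := by
      rw [← Algebra.TensorProduct.tmul_mul_tmul]
      exact (map_mul (Algebra.TensorProduct.assoc k k k H H H) _ _).symm
    rw [regroup, preTwist_assoc_tmul, coev_mul_comul, map_mul, one_tmul_mul,
      smulTwo_mul]
    change _ = _ • Q.smulTwo (Q.preTwist (TensorProduct.assoc k H H H (w ⊗ₜ c))) _
    rw [preTwist_assoc_tmul, ← smulTwo_mul_tmul_one]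
    simp [← smul_tmul']

theorem preTwist_comulRight_tmul_mul (a b : H) (w : H ⊗[k] (H ⊗[k] H)) :
    Q.preTwist (Q.comulRight (a ⊗ₜ b) * w) = Q.counit b • (Q.preTwist w * Q.sinv a ⊗ₜ 1) := by
  induction w with
  | zero => simp
  | add u v hu hv => simp only [mul_add, map_add, hu, hv, smul_add, add_mul]
  | tmul c v =>
    rw [comulRight_tmul, Algebra.TensorProduct.tmul_mul_tmul, preTwist_tmul, preTwist_tmul,
      map_mul, smulTwo_mul, smulTwo_gamma_comulRight_comul]
    simp [sinv_mul, mul_assoc]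

/-- The twist `g = (γ ◁ (X² ⊗ Δ(X³))) (S⁻¹(β) S⁻¹(X¹) ⊗ 1)`, the analogue for the right action
`smulTwo` of Drinfeld's twist relating `Δ ∘ S` to `(S ⊗ S) ∘ Δᵒᵖ`. -/
def twist : H ⊗[k] H := Q.preTwist Q.reassoc

theorem smulTwo_twist_comul (h : H) :
    Q.smulTwo Q.twist (1 ⊗ₜ Q.comul h) = Q.twist * Q.sinv h ⊗ₜ 1 := by
  have left : Q.preTwist (Q.reassoc * Q.comulLeft (Q.comul h)) =
      Q.smulTwo Q.twist (1 ⊗ₜ Q.comul h) :=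
    Q.apply_comul_of_counit_fst
      (Q.preTwist ∘ₗ LinearMap.mulLeft k _ ∘ₗ Q.comulLeft.toLinearMap)
      (Q.smulTwo Q.twist ∘ₗ TensorProduct.mk k H _ 1 ∘ₗ Q.comul.toLinearMap)
      (Q.preTwist_mul_comulLeft_tmul _) h
  have right : Q.preTwist (Q.comulRight (Q.comul h) * Q.reassoc) = Q.twist * Q.sinv h ⊗ₜ 1 :=
    Q.apply_comul_of_counit_snd
      (Q.preTwist ∘ₗ LinearMap.mulRight k _ ∘ₗ Q.comulRight.toLinearMap)
      (LinearMap.mulLeft k Q.twist ∘ₗ (TensorProduct.mk k H H).flip 1 ∘ₗ Q.sinv)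
      (fun a b => Q.preTwist_comulRight_tmul_mul a b _) h
  rw [← left, ← right, comulRight_comul_mul_reassoc]

section MulAlphaInv

/-- The map `a ⊗ w ↦ preTwist(w) (S⁻¹(α) a ⊗ 1)`, whose value at `1 ⊗ Φ` is `g (S⁻¹(α) ⊗ 1)`. -/
def preTwistMulAlphaInv : H ⊗[k] (H ⊗[k] (H ⊗[k] H)) →ₗ[k] H ⊗[k] H :=
  LinearMap.mul' k (H ⊗[k] H) ∘ₗ
    TensorProduct.map Q.preTwist
      ((TensorProduct.mk k H H).flip 1 ∘ₗ LinearMap.mulLeft k Q.alphaInv) ∘ₗ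
    (TensorProduct.comm k H (H ⊗[k] (H ⊗[k] H))).toLinearMap

theorem preTwistMulAlphaInv_tmul (a : H) (w : H ⊗[k] (H ⊗[k] H)) :
    Q.preTwistMulAlphaInv (a ⊗ₜ w) = Q.preTwist w * (Q.alphaInv * a) ⊗ₜ 1 := rfl

theorem preTwistMulAlphaInv_comulTrd_mul (c : H) (y : H ⊗[k] (H ⊗[k] (H ⊗[k] H))) :
    Q.preTwistMulAlphaInv (Q.comulTrd (1 ⊗ₜ (1 ⊗ₜ c)) * y) =
      Q.counit c • Q.preTwistMulAlphaInv y := by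
  induction y with
  | zero => simp
  | add u v hu hv => simp only [mul_add, map_add, hu, hv, smul_add]
  | tmul a w =>
    rw [comulTrd_tmul, Algebra.TensorProduct.tmul_mul_tmul, preTwistMulAlphaInv_tmul,
      preTwist_comulRight_tmul_mul, preTwistMulAlphaInv_tmul]
    simp [sinv_one, ← Algebra.TensorProduct.one_def]

theorem preTwistMulAlphaInv_comulFst_mul (x : H) (y : H ⊗[k] (H ⊗[k] (H ⊗[k] H))) :
    Q.preTwistMulAlphaInv (Q.comulFst (x ⊗ₜ 1) * y) = Q.counit x • Q.preTwistMulAlphaInv y := by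
  induction y with
  | zero => simp
  | add u v hu hv => simp only [mul_add, map_add, hu, hv, smul_add]
  | tmul a w =>
    have absorb (d : H ⊗[k] H) : Q.preTwistMulAlphaInv
        (TensorProduct.assoc k H H (H ⊗[k] H) (d ⊗ₜ 1) * a ⊗ₜ w) =
          Q.preTwist w * (Q.sinv (Q.ev d) * a) ⊗ₜ 1 := by
      induction d with
      | zero => simp
      | add u v hu hv => simp only [add_tmul, add_mul, map_add, hu, hv, mul_add]
      | tmul b c =>
        have comulRight_tmul_one : c ⊗ₜ (1 : H ⊗[k] H) = Q.comulRight (c ⊗ₜ 1) := by simp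
        rw [assoc_tmul, Algebra.TensorProduct.tmul_mul_tmul, preTwistMulAlphaInv_tmul,
          comulRight_tmul_one, preTwist_comulRight_tmul_mul, sinv_ev_tmul]
        simp [mul_assoc]
    have ev_comul : Q.ev (Q.comul x) = Q.counit x • Q.alpha := Q.antipode_alpha x
    rw [comulFst_tmul, absorb, ev_comul, preTwistMulAlphaInv_tmul, alphaInv]
    simp [← smul_tmul']

theorem preTwistMulAlphaInv_mul_comulSnd (b : H) (y : H ⊗[k] (H ⊗[k] (H ⊗[k] H))) :
    Q.preTwistMulAlphaInv (y * Q.comulSnd (1 ⊗ₜ (b ⊗ₜ 1))) =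
      Q.counit b • Q.preTwistMulAlphaInv y := by
  induction y with
  | zero => simp
  | add u v hu hv => simp only [add_mul, map_add, hu, hv, smul_add]
  | tmul a w =>
    rw [comulSnd_tmul, Algebra.TensorProduct.tmul_mul_tmul, preTwistMulAlphaInv_tmul,
      preTwist_mul_comulLeft_tmul, preTwistMulAlphaInv_tmul, map_one,
      ← Algebra.TensorProduct.one_def, smulTwo_one, mul_one, smul_mul_assoc]

theorem preTwistMulAlphaInv_appendThree (w : H ⊗[k] (H ⊗[k] H)) :
    Q.preTwistMulAlphaInv (appendThree k H w) = Q.gamma * Q.sinv (Q.zagzig w) ⊗ₜ 1 := by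
  induction w using tensor_induction_three with
  | zero => simp
  | add u v hu hv => simp only [map_add, add_tmul, mul_add, hu, hv]
  | tmul a b c =>
    have comulRight_eq : Q.comulRight (c ⊗ₜ 1) = appendTwo k H (c ⊗ₜ 1) := by
      simp [Algebra.TensorProduct.one_def]
    rw [appendThree_tmul, appendTwo_tmul, preTwistMulAlphaInv_tmul, preTwist_tmul, comulRight_eq,
      smulTwo_appendTwo]
    simp [sinv_mul, sinv_S, alphaInv, mul_assoc]

theorem twist_mul_alphaInv : Q.twist * Q.alphaInv ⊗ₜ 1 = Q.gamma := by
  calc Q.twist * Q.alphaInv ⊗ₜ 1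
    _ = Q.preTwistMulAlphaInv (1 ⊗ₜ Q.reassoc) := by
      rw [preTwistMulAlphaInv_tmul, mul_one, twist]
    _ = Q.preTwistMulAlphaInv (Q.comulTrd Q.reassocInv *
          (1 : H) ⊗ₜ[k] (Q.reassoc : H ⊗[k] (H ⊗[k] H))) :=
      (Q.apply_mul_of_counit_trd Q.counit_trd_inv _ _ Q.preTwistMulAlphaInv_comulTrd_mul _).symm
    _ = Q.preTwistMulAlphaInv (Q.comulFst Q.reassoc *
          (appendThree k H Q.reassocInv * Q.comulSnd Q.reassocInv)) := by
      rw [comulTrd_inv_mul, mul_assoc]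
    _ = Q.preTwistMulAlphaInv (appendThree k H Q.reassocInv * Q.comulSnd Q.reassocInv) :=
      Q.apply_mul_of_counit_fst Q.counit_fst _ _ Q.preTwistMulAlphaInv_comulFst_mul _
    _ = Q.preTwistMulAlphaInv (appendThree k H Q.reassocInv) :=
      Q.apply_mul_of_counit_snd Q.counit_snd_inv _ _ Q.preTwistMulAlphaInv_mul_comulSnd _
    _ = Q.gamma := by
      rw [preTwistMulAlphaInv_appendThree, zagzig_reassocInv, sinv_one,
        ← Algebra.TensorProduct.one_def, mul_one]

end MulAlphaInv

section Counit

theorem counitSnd_gamma : Q.counitSnd Q.gamma = Q.alphaInv := by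
  have absorb := Q.apply_mul_of_counit_snd Q.counit_snd_inv (AlgHom.id k _)
    (Q.counitSnd.toLinearMap ∘ₗ Q.smulTwo (Q.comul Q.alphaInv)) (fun b y => by
      simp [smulTwo_mul, sinv_one]) 1
  simpa [smulTwo_one, gamma] using absorb

theorem counitSnd_smulTwo_tmul_comul (t : H ⊗[k] H) (a c : H) :
    Q.counitSnd (Q.smulTwo t (a ⊗ₜ Q.comul c)) = Q.sinv c * Q.counitSnd t * a :=
  Q.apply_comul_of_counit_fst
    (Q.counitSnd.toLinearMap ∘ₗ Q.smulTwo t ∘ₗ TensorProduct.mk k H _ a)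
    (LinearMap.mulRight k a ∘ₗ LinearMap.mulRight k (Q.counitSnd t) ∘ₗ Q.sinv)
    (fun b c => by simp [mul_assoc]) c

theorem counitSnd_preTwist (w : H ⊗[k] (H ⊗[k] H)) :
    Q.counitSnd (Q.preTwist w) = Q.sinv (Q.zigzag w) := by
  induction w using tensor_induction_three with
  | zero => simp
  | add u v hu hv => simp only [map_add, hu, hv]
  | tmul a b c =>
    rw [preTwist_tmul, comulRight_tmul, map_mul, counitSnd_smulTwo_tmul_comul, counitSnd_gamma,
      zigzag_tmul, sinv_mul, sinv_ev_tmul]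
    simp [sinv_mul]

theorem counitSnd_twist : Q.counitSnd Q.twist = 1 := by
  rw [twist, counitSnd_preTwist, zigzag_reassoc, sinv_one]

end Counit

section Coproduct

theorem smulThree_comulLeft_mul_appendTwo (s t v : H ⊗[k] H) (a : H) :
    Q.smulThree (Q.comulLeft s * appendTwo k H t) (1 ⊗ₜ (a ⊗ₜ v)) =
      Q.comulLeft (Q.smulTwo s (1 ⊗ₜ v)) * appendTwo k H (t * 1 ⊗ₜ a) := by
  induction v with
  | zero => simp
  | add u v hu hv => simp only [tmul_add, map_add, add_mul, hu, hv]
  | tmul b c =>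
    have commute : Q.comulLeft (1 ⊗ₜ b) * appendTwo k H t =
        appendTwo k H t * Q.comulLeft (1 ⊗ₜ b) := by
      induction t with
      | zero => simp
      | add u v hu hv => simp only [map_add, add_mul, mul_add, hu, hv]
      | tmul x y => simp [Algebra.TensorProduct.one_def]
    have split : (1 : H) ⊗ₜ[k] (a ⊗ₜ[k] b) =
        Q.comulLeft (1 ⊗ₜ b) * appendTwo k H (1 ⊗ₜ a) := by
      simp [Algebra.TensorProduct.one_def]
    rw [smulThree_tmul, smulTwo_tmul, map_mul, map_mul, map_mul, split, mul_assoc, mul_assoc,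
      mul_assoc, ← mul_assoc (appendTwo k H t), ← commute, mul_assoc]
    rfl

theorem smulThree_comulLeft_mul_appendTwo_twist (v : H ⊗[k] H) :
    Q.smulThree (Q.comulLeft Q.twist * appendTwo k H Q.twist) (1 ⊗ₜ Q.comulRight v) =
      Q.comulLeft Q.twist * appendTwo k H (Q.smulTwo Q.twist (1 ⊗ₜ v)) := by
  induction v with
  | zero => simp
  | add u v hu hv => simp only [tmul_add, map_add, mul_add, hu, hv]
  | tmul b c =>
    rw [comulRight_tmul, smulThree_comulLeft_mul_appendTwo, smulTwo_twist_comul, smulTwo_tmul,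
      map_mul, comulLeft_tmul_one, mul_assoc, ← map_mul]

theorem comulLeft_twist_mul_appendTwo_smulTwo (w : H ⊗[k] (H ⊗[k] H)) :
    Q.comulLeft Q.twist * appendTwo k H (Q.smulTwo (Q.comul Q.alphaInv) w) =
      Q.smulThree (Q.comulLeft Q.gamma) (Q.comulTrd w) := by
  induction w using tensor_induction_three with
  | zero => simp
  | add u v hu hv => simp only [map_add, mul_add, hu, hv]
  | tmul a b c =>
    have split : Q.comulTrd (a ⊗ₜ (b ⊗ₜ c)) =
        Q.comulFst (1 ⊗ₜ Q.comul c) * appendThree k H (appendTwo k H (a ⊗ₜ b)) := by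
      simp only [comulTrd_tmul, comulRight_tmul, comulFst_tmul, map_one,
        Algebra.TensorProduct.one_def, assoc_tmul, appendTwo_tmul, appendThree_tmul,
        Algebra.TensorProduct.tmul_mul_tmul, one_mul]
      rw [← Algebra.TensorProduct.one_def, mul_one]
    calc Q.comulLeft Q.twist * appendTwo k H (Q.smulTwo (Q.comul Q.alphaInv) (a ⊗ₜ (b ⊗ₜ c)))
      _ = Q.comulLeft (Q.twist * Q.sinv c ⊗ₜ 1 * Q.alphaInv ⊗ₜ 1) *
            appendTwo k H (a ⊗ₜ b) := by
        simp only [smulTwo_tmul, map_mul, comulLeft_tmul_one, mul_assoc]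
      _ = Q.comulLeft (Q.smulTwo Q.gamma (1 ⊗ₜ Q.comul c)) * appendTwo k H (a ⊗ₜ b) := by
        rw [← smulTwo_twist_comul, smulTwo_mul_tmul_one, twist_mul_alphaInv]
      _ = Q.smulThree (Q.comulLeft Q.gamma) (Q.comulTrd (a ⊗ₜ (b ⊗ₜ c))) := by
        rw [comulLeft_smulTwo, split, smulThree_mul, smulThree_appendThree]

theorem eq_of_mul_alphaInv_eq {s t : H ⊗[k] (H ⊗[k] H)}
    (hs : ∀ h, Q.smulThree s (1 ⊗ₜ Q.comulRight (Q.comul h)) = s * Q.sinv h ⊗ₜ 1)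
    (ht : ∀ h, Q.smulThree t (1 ⊗ₜ Q.comulRight (Q.comul h)) = t * Q.sinv h ⊗ₜ 1)
    (eq : s * Q.alphaInv ⊗ₜ 1 = t * Q.alphaInv ⊗ₜ 1) : s = t := by
  let includeFst : H →ₐ[k] H ⊗[k] (H ⊗[k] H) := Algebra.TensorProduct.includeLeft
  let p : Submodule k H := LinearMap.eqLocus
    (LinearMap.mulLeft k s ∘ₗ includeFst.toLinearMap)
    (LinearMap.mulLeft k t ∘ₗ includeFst.toLinearMap)
  have mem_iff (r : H) : r ∈ p ↔ s * r ⊗ₜ 1 = t * r ⊗ₜ 1 := Iff.rfl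
  have split (a b : H) : (a * b) ⊗ₜ[k] (1 : H ⊗[k] H) = a ⊗ₜ 1 * b ⊗ₜ 1 := by simp
  have one_mem : (1 : H) ∈ p := by
    refine Q.one_mem_of_alphaInv_mem eq (fun c r hr => ?_) (fun c r hr => ?_)
    · rw [mem_iff] at hr ⊢
      rw [split, ← mul_assoc, ← hs, smulThree_mul_tmul_one, hr, ← smulThree_mul_tmul_one, ht,
        mul_assoc]
    · rw [mem_iff] at hr ⊢
      rw [split, ← mul_assoc, hr, mul_assoc]
  simpa [← Algebra.TensorProduct.one_def] using (mem_iff 1).mp one_mem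

theorem coaction_gamma : Q.coaction Q.gamma = Q.smulThree (Q.comulThree Q.alphaInv)
    (appendThree k H Q.reassocInv * Q.comulSnd Q.reassocInv) := by
  rw [gamma, coaction_smulTwo, ← mul_one (Q.comul _), coaction_comul_mul, smulThree_mul,
    smulThree_appendThree, coaction_apply, map_one, mul_one]

theorem comulLeft_twist_mul_appendTwo_twist :
    Q.comulLeft Q.twist * appendTwo k H Q.twist =
      Q.smulThree (Q.coaction Q.twist) (1 ⊗ₜ Q.reassocInv) := by
  refine Q.eq_of_mul_alphaInv_eq (fun h => ?_) (fun h => ?_) ?_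
  · rw [smulThree_comulLeft_mul_appendTwo_twist, smulTwo_twist_comul, map_mul, ← mul_assoc]
    rfl
  · have comulSnd_one_tmul (v : H ⊗[k] H) : (1 : H) ⊗ₜ Q.comulLeft v = Q.comulSnd (1 ⊗ₜ v) := rfl
    rw [← smulThree_mul, ← one_tmul_mul, reassocInv_mul_comulRight_comul, one_tmul_mul,
      smulThree_mul, comulSnd_one_tmul, ← coaction_smulTwo, smulTwo_twist_comul,
      coaction_tmul_one, smulThree_mul_tmul_one]
  · calc Q.comulLeft Q.twist * appendTwo k H Q.twist * Q.alphaInv ⊗ₜ 1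
      _ = Q.comulLeft Q.twist * appendTwo k H (Q.twist * Q.alphaInv ⊗ₜ 1) := by
        rw [map_mul, ← mul_assoc]; rfl
      _ = Q.smulThree (Q.comulThree Q.alphaInv)
            (Q.comulFst Q.reassocInv * Q.comulTrd Q.reassocInv) := by
        rw [twist_mul_alphaInv, gamma, comulLeft_twist_mul_appendTwo_smulTwo, gamma,
          comulLeft_smulTwo, smulThree_mul]
        rfl
      _ = Q.smulThree (Q.coaction (Q.twist * Q.alphaInv ⊗ₜ 1)) (1 ⊗ₜ Q.reassocInv) := by
        rw [twist_mul_alphaInv, coaction_gamma, ← smulThree_mul,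
          appendThree_inv_mul_comulSnd_inv_mul]
      _ = Q.smulThree (Q.coaction Q.twist) (1 ⊗ₜ Q.reassocInv) * Q.alphaInv ⊗ₜ 1 := by
        rw [coaction_tmul_one, smulThree_mul_tmul_one]

end Coproduct

end Twist

section Representation

/-- The action `L_h(m) = Δ(h) m` of the left tensor factor of the crossed product. -/
def actLeft : H →ₐ[k] Module.End k (H ⊗[k] H) := (Algebra.lmul k (H ⊗[k] H)).comp Q.comul

/-- The action `D_φ(m) = (id ⊗ id ⊗ φ)(Φ⁻¹ (id ⊗ Δ)(m) (1 ⊗ g))` of the middle tensor factor of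
the crossed product. -/
def actDual : Module.Dual k H →ₗ[k] Module.End k (H ⊗[k] H) :=
  LinearMap.lcomp k _ (LinearMap.mulRight k (1 ⊗ₜ Q.twist) ∘ₗ Q.coaction) ∘ₗ evalTrd

/-- The action `R_l(m) = m (1 ⊗ S⁻¹(l))` of the right tensor factor of the crossed product. -/
def actRight : H →ₗ[k] Module.End k (H ⊗[k] H) :=
  (LinearMap.mul k (H ⊗[k] H)).flip ∘ₗ TensorProduct.mk k H H 1 ∘ₗ Q.sinv

/-- The representation `h ⊗ φ ⊗ l ↦ L_h D_φ R_l` of the crossed product on `H ⊗ H`. -/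
def act : H ⊗[k] (Module.Dual k H ⊗[k] H) →ₗ[k] Module.End k (H ⊗[k] H) :=
  LinearMap.mul' k _ ∘ₗ TensorProduct.map Q.actLeft.toLinearMap
    (LinearMap.mul' k _ ∘ₗ TensorProduct.map Q.actDual Q.actRight)

@[simp] theorem actLeft_apply (h : H) (m : H ⊗[k] H) : Q.actLeft h m = Q.comul h * m := rfl

@[simp] theorem actDual_apply (φ : Module.Dual k H) (m : H ⊗[k] H) :
    Q.actDual φ m = evalTrd φ (Q.coaction m * 1 ⊗ₜ Q.twist) := rfl

@[simp] theorem actRight_apply (l : H) (m : H ⊗[k] H) :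
    Q.actRight l m = m * 1 ⊗ₜ Q.sinv l := rfl

theorem act_tmul (h l : H) (φ : Module.Dual k H) :
    Q.act (h ⊗ₜ (φ ⊗ₜ l)) = Q.actLeft h * (Q.actDual φ * Q.actRight l) := rfl

theorem act_tmul_apply (h l : H) (φ : Module.Dual k H) (m : H ⊗[k] H) :
    Q.act (h ⊗ₜ (φ ⊗ₜ l)) m =
      Q.comul h * evalTrd φ (Q.coaction m * 1 ⊗ₜ (Q.comul (Q.sinv l) * Q.twist)) := by
  simp [act_tmul, coaction_mul, mul_assoc]

theorem smulThree_coaction_twist (w₁ w₂ w₃ : H) :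
    Q.smulThree (Q.coaction Q.twist) (1 ⊗ₜ (w₁ ⊗ₜ (w₂ ⊗ₜ w₃))) =
      Q.coaction (Q.comul (Q.sinv w₃) * Q.twist) * 1 ⊗ₜ (w₁ ⊗ₜ w₂) := by
  rw [smulThree_tmul, coaction_comul_mul, mul_assoc]

theorem smulThree_coaction_twist_rightLeg (l l' : H) :
    Q.smulThree (Q.coaction Q.twist) (1 ⊗ₜ Q.rightLeg l l') =
      Q.comulLeft (Q.comul (Q.sinv l') * Q.twist) *
        appendTwo k H (Q.comul (Q.sinv l) * Q.twist) := by
  have rightLeg_eq : (1 : H) ⊗ₜ[k] Q.rightLeg l l' =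
      (1 : H) ⊗ₜ[k] Q.reassocInv * (1 : H) ⊗ₜ Q.comulRight (1 ⊗ₜ l) *
        (1 : H) ⊗ₜ ((1 : H) ⊗ₜ ((1 : H) ⊗ₜ l')) := by
    simp [rightLeg, reassocInv]
  rw [rightLeg_eq, smulThree_mul, smulThree_mul, ← comulLeft_twist_mul_appendTwo_twist,
    smulThree_comulLeft_mul_appendTwo_twist, smulThree_tmul, smulTwo_tmul, map_mul Q.comulLeft,
    ← Algebra.TensorProduct.one_def, ← Algebra.TensorProduct.one_def, mul_one, mul_one, mul_assoc]
  rfl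

theorem act_assemble_apply (u w : H ⊗[k] (H ⊗[k] H)) (φ ψ : Module.Dual k H) (m : H ⊗[k] H) :
    Q.act (Q.assemble (u ⊗ₜ ((φ ⊗ₜ ψ) ⊗ₜ w))) m =
      evalTrdFth φ ψ (Q.comulFst u * (Q.comulTrd (Q.coaction m) *
        1 ⊗ₜ[k] (Q.reassoc * Q.smulThree (Q.coaction Q.twist) (1 ⊗ₜ w)))) := by
  induction u using tensor_induction_three with
  | zero => simp
  | add x y hx hy => simp only [add_tmul, map_add, LinearMap.add_apply, add_mul, hx, hy]
  | tmul u₁ u₂ u₃ =>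
    induction w using tensor_induction_three with
    | zero => simp
    | add x y hx hy => simp only [tmul_add, map_add, LinearMap.add_apply, mul_add, hx, hy]
    | tmul w₁ w₂ w₃ =>
      rw [assemble_tmul, act_tmul_apply, smulThree_coaction_twist, ← mul_assoc _ (Q.coaction _),
        reassoc_mul_coaction, one_tmul_mul (Q.comulRight _), ← mul_assoc (Q.comulTrd _),
        evalTrdFth_comulFst_mul_mul, ← evalTrdFth_comulTrd, map_mul, comulTrd_tmul]

theorem act_crossedMul (x y : H ⊗[k] (Module.Dual k H ⊗[k] H)) :
    Q.act (Q.crossedMul x y) = Q.act x * Q.act y := by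
  induction x using tensor_induction_three with
  | zero => simp
  | add x x' hx hx' => simp only [map_add, LinearMap.add_apply, add_mul, hx, hx']
  | tmul h φ l =>
    induction y using tensor_induction_three with
    | zero => simp
    | add y y' hy hy' => simp only [map_add, mul_add, hy, hy']
    | tmul h' ψ l' =>
      refine LinearMap.ext fun m => ?_
      let t := Q.comul (Q.sinv l) * Q.twist
      let t' := Q.comul (Q.sinv l') * Q.twist
      have twists : Q.comulSnd (1 ⊗ₜ t') * appendThree k H (1 ⊗ₜ t) =
          1 ⊗ₜ Q.smulThree (Q.coaction Q.twist) (1 ⊗ₜ Q.rightLeg l l') := by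
        rw [smulThree_coaction_twist_rightLeg, one_tmul_mul (Q.comulLeft _)]
        rfl
      symm
      calc Q.act (h ⊗ₜ (φ ⊗ₜ l)) (Q.act (h' ⊗ₜ (ψ ⊗ₜ l')) m)
        _ = Q.comul h * evalTrd φ (Q.coaction (evalTrd ψ
              (appendTwo k H (Q.comul h') * Q.coaction m * 1 ⊗ₜ t')) * 1 ⊗ₜ t) := by
          rw [act_tmul_apply, act_tmul_apply, mul_assoc, evalTrd_appendTwo_mul]
        _ = evalTrdFth φ ψ (appendThree k H (appendTwo k H (Q.comul h) * Q.reassocInv) *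
              Q.comulSnd (appendTwo k H (Q.comul h') * Q.coaction m) *
              (Q.comulSnd (1 ⊗ₜ t') * appendThree k H (1 ⊗ₜ t))) := by
          rw [coaction_evalTrd, ← lTensor_evalTrd_mul_appendThree, ← evalTrd_appendTwo_mul,
            ← lTensor_evalTrd_appendThree_mul, map_mul (appendThree k H),
            map_mul Q.comulSnd _ (1 ⊗ₜ t')]
          simp only [mul_assoc]
          rfl
        _ = Q.act (Q.assemble (Q.leftLeg h h' ⊗ₜ ((φ ⊗ₜ ψ) ⊗ₜ Q.rightLeg l l'))) m := by
          rw [twists, ← comulFst_leftLeg_mul, act_assemble_apply, one_tmul_mul, mul_assoc,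
            mul_assoc]

theorem actRight_one : Q.actRight 1 = 1 :=
  LinearMap.ext fun m => by simp [sinv_one, ← Algebra.TensorProduct.one_def]

theorem actDual_counit : Q.actDual Q.counit.toLinearMap = 1 := by
  refine LinearMap.ext fun m => ?_
  have reassocInv : Algebra.TensorProduct.map (AlgHom.id k H) Q.counitSnd Q.reassocInv = 1 := by
    rw [counitSnd, ← AlgHom.comp_id (AlgHom.id k H), Algebra.TensorProduct.map_comp,
      AlgHom.comp_apply, AlgHom.comp_id, counit_trd_inv, map_one]
  have comulRight : Algebra.TensorProduct.map (AlgHom.id k H) Q.counitSnd (Q.comulRight m) = m := by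
    induction m with
    | zero => simp
    | add u v hu hv => simp only [map_add, hu, hv]
    | tmul a b => simp
  rw [actDual_apply, evalTrd_counit, coaction_apply, map_mul, map_mul, reassocInv, comulRight]
  simp [counitSnd_twist, ← Algebra.TensorProduct.one_def]

theorem act_crossedOne : Q.act Q.crossedOne = 1 := by
  rw [crossedOne, act_tmul, map_one, actDual_counit, actRight_one, one_mul, one_mul]

end Representation

section Range

/-- The image of the representation `act`, an algebra of endomorphisms of `H ⊗ H`. -/
def actRange : Subalgebra k (Module.End k (H ⊗[k] H)) :=
  (LinearMap.range Q.act).toSubalgebra ⟨_, Q.act_crossedOne⟩ (by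
    rintro _ _ ⟨x, rfl⟩ ⟨y, rfl⟩
    exact ⟨_, Q.act_crossedMul x y⟩)

theorem actLeft_mem (h : H) : Q.actLeft h ∈ Q.actRange :=
  ⟨h ⊗ₜ (Q.counit.toLinearMap ⊗ₜ 1), by
    rw [act_tmul, actDual_counit, actRight_one, one_mul, mul_one]⟩

theorem actDual_mem (φ : Module.Dual k H) : Q.actDual φ ∈ Q.actRange :=
  ⟨1 ⊗ₜ (φ ⊗ₜ 1), by rw [act_tmul, map_one, actRight_one, one_mul, mul_one]⟩

theorem actRight_mem (l : H) : Q.actRight l ∈ Q.actRange :=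
  ⟨1 ⊗ₜ (Q.counit.toLinearMap ⊗ₜ l), by rw [act_tmul, map_one, actDual_counit, one_mul, one_mul]⟩

theorem mulRight_one_tmul_mem (a : H) : LinearMap.mulRight k (1 ⊗ₜ[k] a) ∈ Q.actRange := by
  convert Q.actRight_mem (Q.S a)
  exact LinearMap.ext fun m => by simp [sinv_S]

/-- The elements `t` for which all the variants `m ↦ (id ⊗ id ⊗ φ)(Φ⁻¹ (id ⊗ Δ)(m) (1 ⊗ t))` of
`actDual` lie in the image of the representation. -/
def admissible : Submodule k (H ⊗[k] H) where
  carrier := {t | ∀ φ, evalTrd φ ∘ₗ LinearMap.mulRight k (1 ⊗ₜ t) ∘ₗ Q.coaction ∈ Q.actRange}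
  zero_mem' φ := by
    convert Q.actRange.zero_mem
    exact LinearMap.ext fun m => by simp
  add_mem' {s t} hs ht φ := by
    convert Q.actRange.add_mem (hs φ) (ht φ)
    exact LinearMap.ext fun m => by simp [tmul_add, mul_add]
  smul_mem' c t ht φ := by
    convert Q.actRange.smul_mem (ht φ) c
    exact LinearMap.ext fun m => by simp

theorem twist_mem_admissible : Q.twist ∈ Q.admissible := Q.actDual_mem

theorem smulTwo_mem_admissible {t : H ⊗[k] H} (ht : t ∈ Q.admissible)
    (w : H ⊗[k] (H ⊗[k] H)) : Q.smulTwo t w ∈ Q.admissible := by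
  induction w using tensor_induction_three with
  | zero => simp
  | add u v hu hv => simpa only [map_add] using add_mem hu hv
  | tmul a b c =>
    intro φ
    convert Q.actRange.mul_mem (Q.mulRight_one_tmul_mem a)
      (Q.actRange.mul_mem (ht (regL k H b φ)) (Q.actRight_mem c))
    refine LinearMap.ext fun m => ?_
    simp only [smulTwo_tmul, LinearMap.comp_apply, LinearMap.mulRight_apply,
      Module.End.mul_apply, actRight_apply, coaction_mul, comulRight_tmul]
    rw [← evalTrd_mul_one_tmul, one_tmul_mul, one_tmul_mul]
    simp only [mul_assoc]

theorem one_mem_admissible : 1 ∈ Q.admissible := by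
  have mul_mem {t : H ⊗[k] H} (ht : t ∈ Q.admissible) (w : H ⊗[k] H) : t * w ∈ Q.admissible := by
    rw [← smulTwo_appendTwo]
    exact Q.smulTwo_mem_admissible ht _
  have comul_alphaInv_mem : Q.comul Q.alphaInv ∈ Q.admissible := by
    have smulTwo_gamma : Q.smulTwo Q.gamma Q.reassoc = Q.comul Q.alphaInv := by
      rw [gamma, ← smulTwo_mul, reassoc_inv_mul, smulTwo_one]
    rw [← smulTwo_gamma, ← twist_mul_alphaInv]
    exact Q.smulTwo_mem_admissible (mul_mem Q.twist_mem_admissible _) _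
  have comul_one_mem := Q.one_mem_of_alphaInv_mem
    (p := Q.admissible.comap Q.comul.toLinearMap) comul_alphaInv_mem
    (fun c r hr => ?_) (fun c r hr => ?_)
  · simpa using comul_one_mem
  · have := Q.smulTwo_mem_admissible hr (1 ⊗ₜ (1 ⊗ₜ c))
    simpa [← Algebra.TensorProduct.one_def] using this
  · simpa using mul_mem hr (Q.comul c)

theorem evalTrd_coaction_mem (φ : Module.Dual k H) :
    evalTrd φ ∘ₗ Q.coaction ∈ Q.actRange := by
  simpa [← Algebra.TensorProduct.one_def] using Q.one_mem_admissible φ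

end Range

section Contraction

/-- The contraction `a ⊗ b ⊗ c ↦ a β S(b) f(c)`. -/
def coevMul (f : Module.End k H) : H ⊗[k] (H ⊗[k] H) →ₗ[k] H :=
  LinearMap.mul' k H ∘ₗ TensorProduct.map Q.coev f ∘ₗ
    (TensorProduct.assoc k H H H).symm.toLinearMap

theorem coevMul_assoc_tmul (f : Module.End k H) (w : H ⊗[k] H) (c : H) :
    Q.coevMul f (TensorProduct.assoc k H H H (w ⊗ₜ c)) = Q.coev w * f c := by
  simp [coevMul]

@[simp] theorem coevMul_tmul (f : Module.End k H) (a b c : H) :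
    Q.coevMul f (a ⊗ₜ (b ⊗ₜ c)) = a * Q.beta * Q.S b * f c := rfl

theorem coevMul_tmul_one_mul (f : Module.End k H) (a : H) (w : H ⊗[k] (H ⊗[k] H)) :
    Q.coevMul f (a ⊗ₜ 1 * w) = a * Q.coevMul f w := by
  induction w using tensor_induction_three with
  | zero => simp
  | add u v hu hv => simp only [mul_add, map_add, hu, hv]
  | tmul b c d => simp [mul_assoc]

theorem lTensor_coevMul_comulFst_mul (f : Module.End k H) (a : H) (u : H ⊗[k] H)
    (v w : H ⊗[k] (H ⊗[k] H)) :
    LinearMap.lTensor H (Q.coevMul f) (Q.comulFst (a ⊗ₜ u) * (Q.comulTrd w * 1 ⊗ₜ v)) =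
      Q.comul a * mulTrd k H (Q.coevMul f ∘ₗ LinearMap.mulRight k v ∘ₗ TensorProduct.mk k H _ 1 ∘ₗ
        LinearMap.mulLeft k u ∘ₗ Q.comul.toLinearMap) w := by
  rw [comulFst_tmul]
  induction w using tensor_induction_three with
  | zero => simp
  | add w w' hw hw' => simp only [map_add, add_mul, mul_add, hw, hw']
  | tmul x y z =>
    induction Q.comul a with
    | zero => simp
    | add s s' hs hs' => simp only [add_tmul, map_add, add_mul, hs, hs']
    | tmul b c =>
      have pull : Q.coevMul f (c ⊗ₜ u * (y ⊗ₜ Q.comul z * v)) =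
          c * (y * Q.coevMul f (1 ⊗ₜ (u * Q.comul z) * v)) := by
        simp only [← mul_assoc, ← coevMul_tmul_one_mul, Algebra.TensorProduct.tmul_mul_tmul,
          mul_one, one_mul]
      simp [pull]

theorem lTensor_coevMul_appendThree_mul (f : Module.End k H) (v w : H ⊗[k] (H ⊗[k] H)) :
    LinearMap.lTensor H (Q.coevMul f) (appendThree k H v * Q.comulSnd w) =
      LinearMap.lTensor H Q.coev v * LinearMap.lTensor H f (Q.counitMid w) := by
  induction w using tensor_induction_three with
  | zero => simp
  | add w w' hw hw' => simp only [map_add, mul_add, hw, hw']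
  | tmul x y z =>
    induction v with
    | zero => simp
    | add v v' hv hv' => simp only [map_add, add_mul, hv, hv']
    | tmul a v =>
      simp [appendTwo_mul_assoc_tmul, coevMul_assoc_tmul, coev_mul_comul]

theorem lTensor_zigzag_comulFst_mul_appendThree (a : H) (u : H ⊗[k] H) (v : H ⊗[k] (H ⊗[k] H)) :
    LinearMap.lTensor H Q.zigzag (Q.comulFst (a ⊗ₜ u) * appendThree k H v) =
      Q.comul a * (LinearMap.lTensor H Q.coev v * 1 ⊗ₜ Q.ev u) := by
  rw [comulFst_tmul]
  induction v using tensor_induction_three with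
  | zero => simp
  | add v v' hv hv' => simp only [map_add, add_mul, mul_add, hv, hv']
  | tmul x y z =>
    induction Q.comul a with
    | zero => simp
    | add s s' hs hs' => simp only [add_tmul, map_add, add_mul, hs, hs']
    | tmul b c => simp [ev_mul_tmul, mul_assoc]

theorem lTensor_zigzag_eq_one :
    LinearMap.lTensor H Q.zigzag (Q.comulFst Q.reassoc * appendThree k H Q.reassocInv) = 1 := by
  have absorb_snd (b : H) (y : H ⊗[k] (H ⊗[k] (H ⊗[k] H))) :
      LinearMap.lTensor H Q.zigzag (y * Q.comulSnd (1 ⊗ₜ (b ⊗ₜ 1))) =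
        Q.counit b • LinearMap.lTensor H Q.zigzag y := by
    induction y with
    | zero => simp
    | add y z hy hz => simp only [add_mul, map_add, hy, hz, smul_add]
    | tmul a y =>
      obtain ⟨y, rfl⟩ := (TensorProduct.assoc k H H H).surjective y
      induction y with
      | zero => simp
      | add y z hy hz => simp only [tmul_add, add_mul, map_add, hy, hz, smul_add]
      | tmul s c =>
        rw [comulSnd_tmul, comulLeft_tmul_one, Algebra.TensorProduct.tmul_mul_tmul,
          assoc_tmul_mul_appendTwo]
        simp [zigzag_assoc_tmul, coev_mul_comul]
  have absorb_trd (c : H) (y : H ⊗[k] (H ⊗[k] (H ⊗[k] H))) :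
      LinearMap.lTensor H Q.zigzag (Q.comulTrd (1 ⊗ₜ (1 ⊗ₜ c)) * y) =
        Q.counit c • LinearMap.lTensor H Q.zigzag y := by
    induction y using tensor_induction_three with
    | zero => simp
    | add y z hy hz => simp only [mul_add, map_add, hy, hz, smul_add]
    | tmul a b y => simp [ev_comul_mul]
  rw [comulFst_mul_appendThree_inv, Q.apply_mul_of_counit_snd Q.counit_snd _ _ absorb_snd,
    Q.apply_mul_of_counit_trd Q.counit_trd_inv _ _ absorb_trd, LinearMap.lTensor_tmul,
    zigzag_reassoc, Algebra.TensorProduct.one_def]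

section FiniteDimensional

variable [FiniteDimensional k H]

theorem mulTrd_coaction_mem (t : Module.End k H) : mulTrd k H t ∘ₗ Q.coaction ∈ Q.actRange := by
  induction t using induction_smulRight with
  | zero => simp
  | add s t hs ht => simpa only [map_add, LinearMap.add_comp] using Q.actRange.add_mem hs ht
  | smulRight φ y =>
    rw [mulTrd_smulRight]
    exact Q.actRange.mul_mem (Q.mulRight_one_tmul_mem y) (Q.evalTrd_coaction_mem φ)

theorem lTensor_coevMul_mem (f : Module.End k H) (u v : H ⊗[k] (H ⊗[k] H)) :
    LinearMap.lTensor H (Q.coevMul f) ∘ₗ LinearMap.mulLeft k (Q.comulFst u) ∘ₗ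
      LinearMap.mulRight k (1 ⊗ₜ v) ∘ₗ Q.comulTrd.toLinearMap ∘ₗ Q.coaction ∈ Q.actRange := by
  induction u with
  | zero =>
    convert Q.actRange.zero_mem
    exact LinearMap.ext fun m => by simp
  | add u u' hu hu' =>
    convert Q.actRange.add_mem hu hu'
    exact LinearMap.ext fun m => by simp [add_mul]
  | tmul a u =>
    convert Q.actRange.mul_mem (Q.actLeft_mem a) (Q.mulTrd_coaction_mem (Q.coevMul f ∘ₗ
      LinearMap.mulRight k v ∘ₗ TensorProduct.mk k H _ 1 ∘ₗ LinearMap.mulLeft k u ∘ₗ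
        Q.comul.toLinearMap))
    refine LinearMap.ext fun m => ?_
    simp only [LinearMap.comp_apply, LinearMap.mulLeft_apply, LinearMap.mulRight_apply,
      AlgHom.toLinearMap_apply, lTensor_coevMul_comulFst_mul]
    rfl

theorem mulLeft_coev_lTensor_mem (f : Module.End k H) :
    LinearMap.mulLeft k (LinearMap.lTensor H Q.coev Q.reassocInv) ∘ₗ LinearMap.lTensor H f ∈
      Q.actRange := by
  convert Q.lTensor_coevMul_mem f Q.reassocInv Q.reassoc
  refine LinearMap.ext fun m => ?_
  simp only [LinearMap.comp_apply, LinearMap.mulLeft_apply, LinearMap.mulRight_apply,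
    AlgHom.toLinearMap_apply]
  rw [comulFst_reassocInv_mul_comulTrd_coaction, lTensor_coevMul_appendThree_mul,
    counitMid_coaction]

theorem lTensor_mem (f : Module.End k H) : LinearMap.lTensor H f ∈ Q.actRange := by
  have key (u : H ⊗[k] (H ⊗[k] H)) : LinearMap.mulLeft k (LinearMap.lTensor H Q.zigzag
      (Q.comulFst u * appendThree k H Q.reassocInv)) ∘ₗ LinearMap.lTensor H f ∈ Q.actRange := by
    induction u with
    | zero =>
      convert Q.actRange.zero_mem
      exact LinearMap.ext fun m => by simp
    | add u u' hu hu' =>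
      convert Q.actRange.add_mem hu hu'
      exact LinearMap.ext fun m => by simp [add_mul]
    | tmul a u =>
      convert Q.actRange.mul_mem (Q.actLeft_mem a)
        (Q.mulLeft_coev_lTensor_mem (LinearMap.mulLeft k (Q.ev u) ∘ₗ f))
      refine LinearMap.ext fun m => ?_
      have lTensor_mulLeft (n : H ⊗[k] H) :
          LinearMap.lTensor H (LinearMap.mulLeft k (Q.ev u)) n = 1 ⊗ₜ Q.ev u * n := by
        induction n with
        | zero => simp
        | add n n' hn hn' => simp only [map_add, mul_add, hn, hn']
        | tmul x y => simp
      simp only [LinearMap.comp_apply, LinearMap.mulLeft_apply, Module.End.mul_apply,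
        actLeft_apply, LinearMap.lTensor_comp, lTensor_mulLeft,
        lTensor_zigzag_comulFst_mul_appendThree, mul_assoc]
  simpa [lTensor_zigzag_eq_one] using key Q.reassoc

theorem map_mulLeft_smulRight_mem (a y : H) (ξ : Module.Dual k H) :
    TensorProduct.map (LinearMap.mulLeft k a) (ξ.smulRight y) ∈ Q.actRange := by
  have counit_smulRight (w : H ⊗[k] H) (v : H) :
      LinearMap.lTensor H (Q.counit.toLinearMap.smulRight y) (w * v ⊗ₜ 1) =
        (Q.counitSnd w * v) ⊗ₜ y := by
    induction w with
    | zero => simp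
    | add w w' hw hw' => simp only [add_mul, add_tmul, map_add, hw, hw']
    | tmul b c => simp [smul_tmul']
  convert Q.actRange.mul_mem (Q.lTensor_mem (Q.counit.toLinearMap.smulRight y))
    (Q.actRange.mul_mem (Q.actLeft_mem a) (Q.lTensor_mem (ξ.smulRight 1)))
  refine TensorProduct.ext' fun v x => ?_
  simp [counit_smulRight]

end FiniteDimensional

end Contraction

section Isomorphism

variable [FiniteDimensional k H]

theorem range_endTmulHom_le : (endTmulHom k H).range ≤ Q.actRange := by
  rintro _ ⟨x, rfl⟩
  change endTmulHom k H x ∈ Q.actRange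
  induction x with
  | zero => simp
  | add x y hx hy => simpa only [map_add] using Q.actRange.add_mem hx hy
  | tmul f a =>
    induction f using induction_smulRight with
    | zero => simp
    | add f g hf hg => simpa only [add_tmul, map_add] using Q.actRange.add_mem hf hg
    | smulRight ξ y => rw [endTmulHom_tmul]; exact Q.map_mulLeft_smulRight_mem a y ξ

theorem range_endTmulHom :
    LinearMap.range (endTmulHom k H).toLinearMap = LinearMap.range Q.act := by
  refine Submodule.eq_of_le_of_finrank_le Q.range_endTmulHom_le ?_
  rw [finrank_range_endTmulHom]
  exact LinearMap.finrank_range_le _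

theorem act_injective : Function.Injective Q.act := by
  rw [← LinearMap.ker_eq_bot, ← Submodule.finrank_eq_zero (R := k)]
  have rank_nullity := LinearMap.finrank_range_add_finrank_ker Q.act
  rw [← range_endTmulHom, finrank_range_endTmulHom] at rank_nullity
  lia

/-- The isomorphism of the crossed product with `End(H) ⊗ H`, obtained by comparing the faithful
representations `act` and `endTmulHom` on `H ⊗ H`, which have the same image. -/
noncomputable def crossedEquiv : H ⊗[k] (Module.Dual k H ⊗[k] H) ≃ₗ[k] Module.End k H ⊗[k] H :=
  (LinearEquiv.ofInjective Q.act Q.act_injective).trans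
    ((LinearEquiv.ofEq _ _ Q.range_endTmulHom.symm).trans
      (LinearEquiv.ofInjective (endTmulHom k H).toLinearMap endTmulHom_injective).symm)

theorem endTmulHom_crossedEquiv (x : H ⊗[k] (Module.Dual k H ⊗[k] H)) :
    endTmulHom k H (Q.crossedEquiv x) = Q.act x :=
  congrArg Subtype.val ((LinearEquiv.ofInjective (endTmulHom k H).toLinearMap
    endTmulHom_injective).apply_symm_apply _)

end Isomorphism

end QuasiHopfAlgebra

open QuasiHopfAlgebra in
theorem mainTheorem4 {k H : Type*} [Field k] [Ring H] [Algebra k H] [FiniteDimensional k H]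
    (Q : QuasiHopfAlgebra k H) :
    (∀ x y z : H ⊗[k] (Module.Dual k H ⊗[k] H),
      Q.crossedMul (Q.crossedMul x y) z = Q.crossedMul x (Q.crossedMul y z)) ∧
    (∀ x : H ⊗[k] (Module.Dual k H ⊗[k] H),
      Q.crossedMul Q.crossedOne x = x ∧ Q.crossedMul x Q.crossedOne = x) ∧
    ∃ e : (H ⊗[k] (Module.Dual k H ⊗[k] H)) ≃ₗ[k] (Module.End k H ⊗[k] H),
      e Q.crossedOne = 1 ∧
      ∀ x y : H ⊗[k] (Module.Dual k H ⊗[k] H), e (Q.crossedMul x y) = e x * e y := by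
  have act_injective := Q.act_injective
  have e_injective : Function.Injective (endTmulHom k H) := endTmulHom_injective
  refine ⟨fun x y z => act_injective ?_, fun x => ⟨act_injective ?_, act_injective ?_⟩,
    Q.crossedEquiv, e_injective ?_, fun x y => e_injective ?_⟩
  · rw [act_crossedMul, act_crossedMul, act_crossedMul, act_crossedMul, mul_assoc]
  · rw [act_crossedMul, act_crossedOne, one_mul]
  · rw [act_crossedMul, act_crossedOne, mul_one]
  · rw [endTmulHom_crossedEquiv, act_crossedOne, map_one]
  · rw [map_mul, endTmulHom_crossedEquiv, endTmulHom_crossedEquiv, endTmulHom_crossedEquiv,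
      act_crossedMul]
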